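/- A \emph{coherent configuration} on a finite set $\Omega$ is a pair $\mathcal X=(\Omega,S)$, where $S$ is a partition of $\Omega\times\Omega$ (into \emph{basis relations}) such that the diagonal $1_\Omega$ is a union of elements of $S$, $s^*=\{(\beta,\alpha):(\alpha,\beta)\in s\}\in S$ for all $s\in S$, and for all $r,s,t\in S$ the \emph{intersection number} $c_{rs}^t=|\{\gamma:(\alpha,\gamma)\in r,\ (\gamma,\beta)\in s\}|$ does not depend on the choice of $(\alpha,\beta)\in t$. An \emph{algebraic isomorphism} from $\mathcal X$ to $\mathcal X'=(\Omega',S')$ is a bijection $\varphi:S\to S'$ preserving the intersection numbers; it extends to unions of basis relations. It is \emph{induced by an isomorphism} if there is a bijection $f:\Omega\to\Omega'$ with $\varphi(s)=s^f$ for all $s\in S$. For $m\ge 1$, the \emph{$m$-extension} of $\mathcal X$ is the smallest (i.e. coarsest) coherent configuration on $\Omega^m$ for which all relations $s_1\otimes\cdots\otimes s_m=\{(\alpha,\beta):(\alpha_i,\beta_i)\in s_i\text{ for all }i\}$ with $s_i\in S$, and the relation $1_{\mathrm{Diag}(\Omega^m)}=\{((a,\dots,a),(a,\dots,a)):a\in\Omega\}$,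 are unions of basis relations; its intersection numbers are the \emph{$m$-dimensional intersection numbers} of $\mathcal X$. An algebraic isomorphism $\varphi$ from $\mathcal X$ to $\mathcal X'$ is \emph{$m$-dimensional} if there is an algebraic isomorphism $\psi$ between the $m$-extensions with $\psi(s_1\otimes\cdots\otimes s_m)=\varphi(s_1)\otimes\cdots\otimes\varphi(s_m)$ for all $s_i\in S$ and $\psi(1_{\mathrm{Diag}(\Omega^m)})=1_{\mathrm{Diag}(\Omega'^m)}$. The \emph{separability number} $s(\mathcal X)$ is the smallest positive integer $m$ such that every $m$-dimensional algebraic isomorphism from $\mathcal X$ to a coherent configuration is induced by an isomorphism. Let $d\ge 3$ be a prime and $q=2^d$. The \emph{small Hollmann scheme} of degree $q(q-1)/2$ is the coherent configuration whose basis relations are the orbits on $\Omega\times\Omega$ of the group $\mathrm{P\Gamma L}(2,q)$ in its action on the set $\Omega$ of the $q(q-1)/2$ anisotropic binary quadratic forms over $\mathbb F_q$ up to nonzero scalars (a semilinear bijection $f$ of $\mathbb F_q^2$ with field automorphism $\sigma$ takes the class of $Q$ to the class of $\sigma\circ Q\circ f^{-1}$); equivalently, in its action on the pairs of conjugate points of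 $\mathrm{PG}(1,q^2)\setminus\mathrm{PG}(1,q)$. \textbf{Theorem.} Let $\mathcal X$ be the small Hollmann scheme of degree $q(q-1)/2$, where $q=2^d$ with $d\ge 3$ prime and $d\ne 7,11,13$. Then $s(\mathcal X)\le 3$; moreover, every $3$-dimensional algebraic isomorphism from $\mathcal X$ to a coherent configuration is induced by an isomorphism, i.e. $\mathcal X$ is determined up to isomorphism by its $3$-dimensional intersection numbers. -/

import Mathlib

open scoped LinearAlgebra.Projectivization

/-- The converse relation `r* = {(β, α) : (α, β) ∈ r}`. -/
def converseRel {Ω : Type*} (r : Set (Ω × Ω)) : Set (Ω × Ω) := {p | (p.2, p.1) ∈ r}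

/-- For relations `r, s` and a pair `p = (α, β)`, the number `|α r ∩ β s*|` of points `γ` with
`(α, γ) ∈ r` and `(γ, β) ∈ s`. -/
noncomputable def pathCount {Ω : Type*} (r s : Set (Ω × Ω)) (p : Ω × Ω) : ℕ :=
  {γ : Ω | (p.1, γ) ∈ r ∧ (γ, p.2) ∈ s}.ncard

/-- A coherent configuration on `Ω`, given by its set `S` of basis relations. -/
structure CoherentConfiguration (Ω : Type*) where
  /-- the basis relations -/
  S : Set (Set (Ω × Ω))
  isPartition : Setoid.IsPartition S
  /-- the diagonal is a union of basis relations -/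
  diagonal_union : ∃ T ⊆ S, Set.diagonal Ω = ⋃₀ T
  /-- `S* = S` -/
  converse_eq : converseRel '' S = S
  /-- `|α r ∩ β s*|` does not depend on the choice of `(α, β) ∈ t` -/
  coherent : ∀ r ∈ S, ∀ s ∈ S, ∀ t ∈ S, ∀ p ∈ t, ∀ p' ∈ t, pathCount r s p = pathCount r s p'

namespace CoherentConfiguration

variable {Ω Ω' : Type*}

/-- `S^∪`: the relations of `X`, that is, the unions of basis relations. -/
def relations (X : CoherentConfiguration Ω) : Set (Set (Ω × Ω)) := {R | ∃ T ⊆ X.S, R = ⋃₀ T}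

/-- The partial order: `X ≤ Y` if every relation of `X` is a relation of `Y`. -/
instance : LE (CoherentConfiguration Ω) := ⟨fun X Y => X.relations ⊆ Y.relations⟩

theorem nonempty_of_mem (X : CoherentConfiguration Ω) {t : Set (Ω × Ω)} (ht : t ∈ X.S) :
    t.Nonempty :=
  Setoid.nonempty_of_mem_partition X.isPartition ht

/-- The intersection number `c_{rs}^t`. -/
noncomputable def intersectionNumber (X : CoherentConfiguration Ω) (r s t : X.S) : ℕ :=
  pathCount r.1 s.1 (X.nonempty_of_mem t.2).some

theorem pathCount_eq_intersectionNumber (X : CoherentConfiguration Ω) (r s t : X.S)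
    {p : Ω × Ω} (hp : p ∈ t.1) : pathCount r.1 s.1 p = X.intersectionNumber r s t :=
  X.coherent _ r.2 _ s.2 _ t.2 _ hp _ (X.nonempty_of_mem t.2).some_mem

/-! ### The coherent closure -/

theorem exists_mem (X : CoherentConfiguration Ω) (p : Ω × Ω) : ∃ s ∈ X.S, p ∈ s := by
  obtain ⟨s, hs, -⟩ := X.isPartition.2 p
  exact ⟨s, hs.1, hs.2⟩

theorem eq_of_mem (X : CoherentConfiguration Ω) {p : Ω × Ω} {s t : Set (Ω × Ω)}
    (hs : s ∈ X.S) (ht : t ∈ X.S) (hps : p ∈ s) (hpt : p ∈ t) : s = t :=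
  (X.isPartition.2 p).unique ⟨hs, hps⟩ ⟨ht, hpt⟩

/-- The equivalence relation on `Ω × Ω` whose classes are the basis relations. -/
def toSetoid (X : CoherentConfiguration Ω) : Setoid (Ω × Ω) where
  r p p' := ∃ s ∈ X.S, p ∈ s ∧ p' ∈ s
  iseqv :=
    { refl := fun p => by
        obtain ⟨s, hs, hp⟩ := X.exists_mem p
        exact ⟨s, hs, hp, hp⟩
      symm := by
        rintro p p' ⟨s, hs, hp, hp'⟩
        exact ⟨s, hs, hp', hp⟩
      trans := by
        rintro p p' p'' ⟨s, hs, hp, hp'⟩ ⟨t, ht, hq, hq'⟩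
        exact ⟨s, hs, hp, X.eq_of_mem ht hs hq hp' ▸ hq'⟩ }

theorem toSetoid_iff (X : CoherentConfiguration Ω) {p p' : Ω × Ω} :
    X.toSetoid p p' ↔ ∃ s ∈ X.S, p ∈ s ∧ p' ∈ s := Iff.rfl

/-- A set of pairs is a relation of `X` if and only if it is saturated for `X.toSetoid`. -/
theorem mem_relations_iff (X : CoherentConfiguration Ω) {R : Set (Ω × Ω)} :
    R ∈ X.relations ↔ ∀ p p', X.toSetoid p p' → p ∈ R → p' ∈ R := by
  constructor
  · rintro ⟨T, hT, rfl⟩ p p' h ⟨t, ht, hp⟩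
    obtain ⟨s, hs, hps, hps'⟩ := X.toSetoid_iff.1 h
    exact ⟨t, ht, X.eq_of_mem hs (hT ht) hps hp ▸ hps'⟩
  · intro h
    refine ⟨{s | s ∈ X.S ∧ s ⊆ R}, fun s hs => hs.1, ?_⟩
    ext p
    constructor
    · intro hp
      obtain ⟨s, hs, hps⟩ := X.exists_mem p
      exact ⟨s, ⟨hs, fun p' hp' => h p p' (X.toSetoid_iff.2 ⟨s, hs, hps, hp'⟩) hp⟩, hps⟩
    · rintro ⟨s, hs, hps⟩
      exact hs.2 hps

theorem converse_mem (X : CoherentConfiguration Ω) {s : Set (Ω × Ω)} (hs : s ∈ X.S) :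
    converseRel s ∈ X.S := by
  have h := Set.mem_image_of_mem converseRel hs
  rwa [X.converse_eq] at h

theorem diagonal_mem_relations (X : CoherentConfiguration Ω) :
    Set.diagonal Ω ∈ X.relations := X.diagonal_union

open Classical in
/-- The number of paths through two arbitrary relations of `X` depends only on the basis relation
containing the pair of end points. -/
theorem pathCount_congr [Finite Ω] (X : CoherentConfiguration Ω) {R R' : Set (Ω × Ω)}
    (hR : R ∈ X.relations) (hR' : R' ∈ X.relations) {p p' : Ω × Ω} (h : X.toSetoid p p') :
    pathCount R R' p = pathCount R R' p' := by
  have := Fintype.ofFinite Ω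
  have := Fintype.ofFinite X.S
  have key : ∀ x : Ω × Ω, pathCount R R' x =
      ∑ rs : X.S × X.S, if rs.1.1 ⊆ R ∧ rs.2.1 ⊆ R' then pathCount rs.1.1 rs.2.1 x else 0 := by
    intro x
    have h1 : ∀ A B : Set (Ω × Ω), pathCount A B x =
        ∑ γ : Ω, if (x.1, γ) ∈ A ∧ (γ, x.2) ∈ B then 1 else 0 := by
      intro A B
      rw [pathCount, Set.ncard_eq_toFinset_card', Finset.sum_boole]
      simp
    simp only [h1]
    have h2 : ∀ rs : X.S × X.S, (if rs.1.1 ⊆ R ∧ rs.2.1 ⊆ R' then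
        ∑ γ : Ω, (if (x.1, γ) ∈ rs.1.1 ∧ (γ, x.2) ∈ rs.2.1 then 1 else 0) else 0) =
        ∑ γ : Ω, (if (rs.1.1 ⊆ R ∧ rs.2.1 ⊆ R') ∧
          (x.1, γ) ∈ rs.1.1 ∧ (γ, x.2) ∈ rs.2.1 then 1 else 0) := by
      intro rs
      by_cases hc : rs.1.1 ⊆ R ∧ rs.2.1 ⊆ R' <;> simp [hc]
    simp only [h2]
    rw [Finset.sum_comm]
    refine Finset.sum_congr rfl fun γ _ => ?_
    obtain ⟨a, ha, hxa⟩ := X.exists_mem (x.1, γ)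
    obtain ⟨b, hb, hxb⟩ := X.exists_mem (γ, x.2)
    rw [Finset.sum_eq_single (⟨a, ha⟩, ⟨b, hb⟩)]
    · congr 1
      apply propext
      constructor
      · rintro ⟨hA, hB⟩
        refine ⟨⟨fun y hy => ?_, fun y hy => ?_⟩, hxa, hxb⟩
        · exact X.mem_relations_iff.1 hR _ _ (X.toSetoid_iff.2 ⟨a, ha, hxa, hy⟩) hA
        · exact X.mem_relations_iff.1 hR' _ _ (X.toSetoid_iff.2 ⟨b, hb, hxb, hy⟩) hB
      · rintro ⟨⟨hA, hB⟩, -, -⟩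
        exact ⟨hA hxa, hB hxb⟩
    · rintro ⟨⟨a', ha'⟩, ⟨b', hb'⟩⟩ - hne
      rw [if_neg]
      rintro ⟨-, h3, h4⟩
      apply hne
      simp only [Prod.mk.injEq, Subtype.mk.injEq]
      exact ⟨X.eq_of_mem ha' ha h3 hxa, X.eq_of_mem hb' hb h4 hxb⟩
    · simp
  rw [key, key]
  refine Finset.sum_congr rfl fun rs _ => ?_
  obtain ⟨t, ht, hp, hp'⟩ := X.toSetoid_iff.1 h
  rw [X.coherent _ rs.1.2 _ rs.2.2 _ ht _ hp _ hp']

/-- The finest partition of `Ω × Ω` that is coarser than the partitions of all coherent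
configurations having every element of `T` as a relation. -/
def closureSetoid (T : Set (Set (Ω × Ω))) : Setoid (Ω × Ω) :=
  sSup {e | ∃ Y : CoherentConfiguration Ω, T ⊆ Y.relations ∧ Y.toSetoid = e}

theorem toSetoid_le_closureSetoid {T : Set (Set (Ω × Ω))} (Y : CoherentConfiguration Ω)
    (hY : T ⊆ Y.relations) : Y.toSetoid ≤ closureSetoid T :=
  le_sSup ⟨Y, hY, rfl⟩

/-- Every property of pairs that is invariant for all these configurations is invariant for the
closure. -/
theorem closureSetoid_induction {T : Set (Set (Ω × Ω))} {β : Type*} (F : Ω × Ω → β)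
    (hF : ∀ Y : CoherentConfiguration Ω, T ⊆ Y.relations →
      ∀ p p', Y.toSetoid p p' → F p = F p')
    {p p' : Ω × Ω} (h : closureSetoid T p p') : F p = F p' := by
  have : closureSetoid T ≤ Setoid.ker F := by
    apply sSup_le
    rintro _ ⟨Y, hY, rfl⟩ p p' hp
    exact hF Y hY p p' hp
  exact this h

theorem class_mem_relations {T : Set (Set (Ω × Ω))} (Y : CoherentConfiguration Ω)
    (hY : T ⊆ Y.relations) {r : Set (Ω × Ω)} (hr : r ∈ (closureSetoid T).classes) :
    r ∈ Y.relations := by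
  obtain ⟨x, rfl⟩ := hr
  rw [mem_relations_iff]
  intro p p' h hp
  exact (closureSetoid T).trans
    ((closureSetoid T).symm (toSetoid_le_closureSetoid Y hY h)) hp

/-- The coherent closure `WL(T)`: the smallest coherent configuration on `Ω` for which all
elements of `T` are relations (see `WL_isLeast`). -/
def WL [Finite Ω] (T : Set (Set (Ω × Ω))) : CoherentConfiguration Ω where
  S := (closureSetoid T).classes
  isPartition := Setoid.isPartition_classes _
  diagonal_union := by
    refine ⟨{s | s ∈ (closureSetoid T).classes ∧ s ⊆ Set.diagonal Ω}, fun s hs => hs.1, ?_⟩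
    ext p
    constructor
    · intro hp
      refine ⟨{x | closureSetoid T x p}, ⟨⟨p, rfl⟩, fun x hx => ?_⟩, (closureSetoid T).refl p⟩
      have := closureSetoid_induction (T := T) (fun y => y ∈ Set.diagonal Ω)
        (fun Y _ a b hab => propext
          ⟨Y.mem_relations_iff.1 Y.diagonal_mem_relations a b hab,
            Y.mem_relations_iff.1 Y.diagonal_mem_relations b a (Y.toSetoid.symm hab)⟩) hx
      exact this.mpr hp
    · rintro ⟨s, hs, hp⟩
      exact hs.2 hp
  converse_eq := by
    have hswap : ∀ p p' : Ω × Ω, closureSetoid T p p' → closureSetoid T p.swap p'.swap := by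
      intro p p' h
      have := closureSetoid_induction (T := T)
        (fun y => (Quotient.mk (closureSetoid T) y.swap : Quotient (closureSetoid T)))
        (fun Y hY a b hab => Quotient.sound (s := closureSetoid T) (by
          obtain ⟨s, hs, ha, hb⟩ := Y.toSetoid_iff.1 hab
          exact toSetoid_le_closureSetoid Y hY
            (Y.toSetoid_iff.2 ⟨converseRel s, Y.converse_mem hs, ha, hb⟩))) h
      exact Quotient.exact (s := closureSetoid T) this
    have hconv : ∀ x : Ω × Ω, converseRel {y | closureSetoid T y x} =
        {y | closureSetoid T y x.swap} := by
      intro x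
      ext y
      constructor
      · intro h
        simpa using hswap _ _ h
      · intro h
        have h' := hswap _ _ h
        rw [Prod.swap_swap] at h'
        exact h'
    ext s
    constructor
    · rintro ⟨_, ⟨x, rfl⟩, rfl⟩
      exact ⟨x.swap, hconv x⟩
    · rintro ⟨x, rfl⟩
      exact ⟨_, ⟨x.swap, rfl⟩, by rw [hconv]; simp⟩
  coherent := by
    intro r hr s hs t ht p hp p' hp'
    obtain ⟨x, rfl⟩ := ht
    exact closureSetoid_induction (T := T) (pathCount r s)
      (fun Y hY a b hab => Y.pathCount_congr (class_mem_relations Y hY hr)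
        (class_mem_relations Y hY hs) hab) ((closureSetoid T).trans hp ((closureSetoid T).symm hp'))

theorem WL_isLeast [Finite Ω] (T : Set (Set (Ω × Ω))) :
    T ⊆ (WL T).relations ∧ ∀ Y : CoherentConfiguration Ω, T ⊆ Y.relations → WL T ≤ Y := by
  constructor
  · intro R hR
    refine ⟨{s | s ∈ (closureSetoid T).classes ∧ s ⊆ R}, fun s hs => hs.1, ?_⟩
    ext p
    constructor
    · intro hp
      refine ⟨{x | closureSetoid T x p}, ⟨⟨p, rfl⟩, fun x hx => ?_⟩, (closureSetoid T).refl p⟩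
      have := closureSetoid_induction (T := T) (fun y => y ∈ R)
        (fun Y hY a b hab => propext ⟨Y.mem_relations_iff.1 (hY hR) a b hab,
            Y.mem_relations_iff.1 (hY hR) b a (Y.toSetoid.symm hab)⟩) hx
      exact this.mpr hp
    · rintro ⟨s, hs, hp⟩
      exact hs.2 hp
  · rintro Y hY _ ⟨U, hU, rfl⟩
    rw [mem_relations_iff]
    rintro p p' h ⟨u, hu, hp⟩
    exact ⟨u, hu, Y.mem_relations_iff.1 (class_mem_relations Y hY (hU hu)) p p' h hp⟩

/-! ### Algebraic isomorphisms and the separability number -/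

/-- An algebraic isomorphism from `X` to `X'`: a bijection between the basis relations that
preserves the intersection numbers. -/
structure AlgIso (X : CoherentConfiguration Ω) (X' : CoherentConfiguration Ω') where
  toEquiv : X.S ≃ X'.S
  map_intersectionNumber : ∀ r s t : X.S,
    X.intersectionNumber r s t = X'.intersectionNumber (toEquiv r) (toEquiv s) (toEquiv t)

/-- The induced map `S^∪ → (S')^∪`: a union of basis relations goes to the union of their
images. -/
def AlgIso.mapRel {X : CoherentConfiguration Ω} {X' : CoherentConfiguration Ω'}
    (φ : AlgIso X X') (R : Set (Ω × Ω)) : Set (Ω' × Ω') :=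
  {p | ∃ s : X.S, s.1 ⊆ R ∧ p ∈ (φ.toEquiv s).1}

/-- `φ` is induced by the bijection `f`: it sends every basis relation `s` to `s^f`. Since `φ` is
a bijection from `S` to `S'`, such an `f` satisfies `S^f = S'`, so it is an isomorphism. -/
def AlgIso.IsInducedBy {X : CoherentConfiguration Ω} {X' : CoherentConfiguration Ω'}
    (φ : AlgIso X X') (f : Ω ≃ Ω') : Prop :=
  ∀ s : X.S, (φ.toEquiv s).1 = Prod.map f f '' s.1

/-- The tensor product `s₁ ⊗ ⋯ ⊗ s_m` of relations on `Ω`, a relation on `Ω ^ m`. -/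
def tensorRel {m : ℕ} (s : Fin m → Set (Ω × Ω)) : Set ((Fin m → Ω) × (Fin m → Ω)) :=
  {p | ∀ i, (p.1 i, p.2 i) ∈ s i}

/-- The relation `1_Δ` on `Ω ^ m`, where `Δ = Diag(Ω ^ m)` is the set of constant tuples. -/
def diagRel (Ω : Type*) (m : ℕ) : Set ((Fin m → Ω) × (Fin m → Ω)) :=
  {p | p.1 = p.2 ∧ ∃ a : Ω, p.1 = fun _ => a}

/-- The `m`-extension of `X`: the smallest coherent configuration on `Ω ^ m` that contains the
Cartesian `m`-power of `X` and for which `Diag(Ω ^ m)` is a union of fibers. -/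
def extension [Finite Ω] (X : CoherentConfiguration Ω) (m : ℕ) :
    CoherentConfiguration (Fin m → Ω) :=
  WL ({R | ∃ s : Fin m → X.S, R = tensorRel fun i => (s i).1} ∪ {diagRel Ω m})

/-- `φ` is `m`-dimensional: the algebraic isomorphism `φ^m` between the Cartesian `m`-powers,
`s₁ ⊗ ⋯ ⊗ s_m ↦ φ(s₁) ⊗ ⋯ ⊗ φ(s_m)`, extends to an algebraic isomorphism between the
`m`-extensions that takes the diagonal to the diagonal. -/
def AlgIso.IsDimensional [Finite Ω] [Finite Ω'] {X : CoherentConfiguration Ω}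
    {X' : CoherentConfiguration Ω'} (φ : AlgIso X X') (m : ℕ) : Prop :=
  ∃ ψ : AlgIso (X.extension m) (X'.extension m),
    (∀ s : Fin m → X.S, ψ.mapRel (tensorRel fun i => (s i).1) =
      tensorRel fun i => (φ.toEquiv (s i)).1) ∧
    ψ.mapRel (diagRel Ω m) = diagRel Ω' m

/-- `X` is determined up to isomorphism by its `m`-dimensional intersection numbers: every
`m`-dimensional algebraic isomorphism from `X` to a coherent configuration on a finite set is
induced by a bijection. -/
def IsDeterminedBy.{u} {Ω : Type u} [Finite Ω] (X : CoherentConfiguration Ω) (m : ℕ) : Prop :=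
  ∀ (Ω' : Type u) [Finite Ω'] (X' : CoherentConfiguration Ω') (φ : AlgIso X X'),
    φ.IsDimensional m → ∃ f : Ω ≃ Ω', φ.IsInducedBy f

/-- The separability number `s(X)`: the smallest positive integer `m` such that every
`m`-dimensional algebraic isomorphism from `X` is induced by an isomorphism (and `⊤` if there
were no such `m`). -/
noncomputable def separabilityNumber.{u} {Ω : Type u} [Finite Ω] (X : CoherentConfiguration Ω) :
    ℕ∞ :=
  sInf {n | ∃ m : ℕ, 0 < m ∧ X.IsDeterminedBy m ∧ n = (m : ℕ∞)}

/-! ### The coherent configuration of a permutation group -/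

/-- `inv(G)`: the basis relations are the orbits of `G` on `Ω × Ω`. -/
def inv (G : Subgroup (Equiv.Perm Ω)) : CoherentConfiguration Ω where
  S := Set.range fun p : Ω × Ω => MulAction.orbit G p
  isPartition := by
    constructor
    · rintro ⟨p, hp⟩
      exact Set.notMem_empty p (hp ▸ MulAction.mem_orbit_self p)
    · intro p
      refine ⟨MulAction.orbit G p, ⟨⟨p, rfl⟩, MulAction.mem_orbit_self p⟩, ?_⟩
      rintro _ ⟨⟨x, rfl⟩, hx⟩
      exact (MulAction.orbit_eq_iff.2 hx).symm
  diagonal_union := by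
    refine ⟨Set.range fun a : Ω => MulAction.orbit G (a, a), ?_, ?_⟩
    · rintro _ ⟨a, rfl⟩
      exact ⟨(a, a), rfl⟩
    · ext ⟨a, b⟩
      constructor
      · rintro (rfl : a = b)
        exact ⟨_, ⟨a, rfl⟩, MulAction.mem_orbit_self _⟩
      · rintro ⟨_, ⟨c, rfl⟩, g, hg⟩
        simp only [Prod.smul_mk, Prod.mk.injEq] at hg
        exact hg.1.symm.trans hg.2
  converse_eq := by
    have h : ∀ x : Ω × Ω, converseRel (MulAction.orbit G x) = MulAction.orbit G x.swap := by
      rintro ⟨a, b⟩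
      ext ⟨c, d⟩
      constructor
      · rintro ⟨g, hg⟩
        simp only [Prod.smul_mk, Prod.mk.injEq] at hg
        exact ⟨g, by simp [hg.1, hg.2]⟩
      · rintro ⟨g, hg⟩
        simp only [Prod.swap_prod_mk, Prod.smul_mk, Prod.mk.injEq] at hg
        exact ⟨g, by simp [hg.1, hg.2]⟩
    ext s
    constructor
    · rintro ⟨_, ⟨x, rfl⟩, rfl⟩
      exact ⟨x.swap, (h x).symm⟩
    · rintro ⟨x, rfl⟩
      exact ⟨_, ⟨x.swap, rfl⟩, by rw [h]; simp⟩
  coherent := by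
    rintro _ ⟨x, rfl⟩ _ ⟨y, rfl⟩ _ ⟨z, rfl⟩ p hp p' hp'
    have hpp : p' ∈ MulAction.orbit G p := by
      rwa [MulAction.orbit_eq_iff.2 hp]
    obtain ⟨g, rfl⟩ := hpp
    have hinv : ∀ (w a : Ω × Ω), g • a ∈ MulAction.orbit G w ↔ a ∈ MulAction.orbit G w :=
      fun w a => by rw [← MulAction.orbit_eq_iff, MulAction.orbit_smul, MulAction.orbit_eq_iff]
    refine Set.ncard_congr (fun γ _ => g • γ) ?_ ?_ ?_
    · rintro γ ⟨h1, h2⟩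
      exact ⟨(hinv x (p.1, γ)).2 h1, (hinv y (γ, p.2)).2 h2⟩
    · intro a b _ _ hab
      exact smul_left_cancel g hab
    · rintro γ ⟨h1, h2⟩
      refine ⟨g⁻¹ • γ, ⟨?_, ?_⟩, smul_inv_smul g γ⟩
      · rw [← hinv x]
        simpa using h1
      · rw [← hinv y]
        simpa using h2

end CoherentConfiguration

/-! ### The small Hollmann scheme -/

/-- `f` is a semilinear bijection of `V` with companion field automorphism `σ`; the semilinear
bijections form the group `ΓL(V)`. -/
def IsSemilinear (K : Type*) {V : Type*} [Field K] [AddCommGroup V] [Module K V]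
    (f : V ≃+ V) (σ : K ≃+* K) : Prop :=
  ∀ (c : K) (v : V), f (c • v) = σ c • f v

/-- The point set of the small Hollmann scheme: the anisotropic binary quadratic forms over `K`
up to nonzero scalars. A form corresponds to the pair of its zeros on the projective line over
the quadratic extension of `K`, so for `|K| = q` these points are the `q (q - 1) / 2` pairs of
conjugate points of `PG(1, q ^ 2)` outside `PG(1, q)`. -/
def HollmannPoint (K : Type*) [Field K] : Type _ :=
  {P : ℙ K (QuadraticForm K (Fin 2 → K)) // P.rep.Anisotropic}

instance (K : Type*) [Field K] [Finite K] : Finite (HollmannPoint K) := by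
  have : Finite (QuadraticForm K (Fin 2 → K)) := DFunLike.finite _
  have : Finite (ℙ K (QuadraticForm K (Fin 2 → K))) := Quotient.finite _
  exact Subtype.finite

/-- The permutation group induced by `ΓL(2, K)`, hence by `PΓL(2, K)`, on the classes of
anisotropic binary quadratic forms: the semilinear map `f` with automorphism `σ` takes the class
of the form `Q` to the class of `σ ∘ Q ∘ f⁻¹`. -/
def PGammaL (K : Type*) [Field K] : Subgroup (Equiv.Perm (HollmannPoint K)) where
  carrier := {π | ∃ (f : (Fin 2 → K) ≃+ (Fin 2 → K)) (σ : K ≃+* K), IsSemilinear K f σ ∧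
    ∀ P : HollmannPoint K, ∃ c : Kˣ, ∀ v, (π P).1.rep v = c * σ (P.1.rep (f.symm v))}
  one_mem' := ⟨AddEquiv.refl _, RingEquiv.refl K, fun _ _ => rfl, fun P => ⟨1, fun v => by simp⟩⟩
  mul_mem' := by
    rintro π₁ π₂ ⟨f₁, σ₁, h₁, H₁⟩ ⟨f₂, σ₂, h₂, H₂⟩
    refine ⟨f₂.trans f₁, σ₂.trans σ₁, fun c v => ?_, fun P => ?_⟩
    · simp [h₁ _ _, h₂ _ _]
    · obtain ⟨c₁, hc₁⟩ := H₁ (π₂ P)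
      obtain ⟨c₂, hc₂⟩ := H₂ P
      refine ⟨c₁ * Units.map (σ₁ : K →* K) c₂, fun v => ?_⟩
      rw [Equiv.Perm.mul_apply, hc₁, hc₂]
      simp [mul_assoc]
  inv_mem' := by
    rintro π ⟨f, σ, h, H⟩
    refine ⟨f.symm, σ.symm, fun c v => ?_, fun P => ?_⟩
    · apply f.injective
      simp [h _ _]
    · obtain ⟨c, hc⟩ := H (π⁻¹ P)
      refine ⟨(Units.map (σ.symm : K →* K) c)⁻¹, fun v => ?_⟩
      have h1 := hc (f v)
      rw [← Equiv.Perm.mul_apply, mul_inv_cancel, Equiv.Perm.one_apply, AddEquiv.symm_apply_apply]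
        at h1
      simp [h1]

/-- The small Hollmann scheme over the finite field `K`. -/
def smallHollmannScheme (K : Type*) [Field K] : CoherentConfiguration (HollmannPoint K) :=
  CoherentConfiguration.inv (PGammaL K)

/-!
The `3`-extension of `X` distinguishes points over a triple `(x₁, x₂, x₃)`, and the resulting
partition of the points is equitable. If it is discrete, then for a `3`-dimensional algebraic
isomorphism `φ` the image of the triple pins down the image of every point, and this map
induces `φ`; so it is enough to find such a triple.

A pair of points of the small Hollmann scheme has an invariant in `K`, which `PΓL(2, q)` changes
only by a field automorphism. Since `d` is prime, at most `2dq` points fail to distinguish two given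
points, and at most `4d²` points look alike from two given points. If `d ≥ 17`, then
`q(q - 1) / 2` exceeds these numbers by so much that some third point leaves more than `2dq` points
isolated, and every two points are distinguished by one of those. For `d = 3` the scheme has rank
two, and for `d = 5` an explicit triple works after one refinement step.
-/

/-! ### Algebraic isomorphisms as correspondences between pairs of points -/

namespace CoherentConfiguration

section Relations

variable {Ω : Type*} (X : CoherentConfiguration Ω)

theorem mem_relations_of_mem {s : Set (Ω × Ω)} (hs : s ∈ X.S) : s ∈ X.relations :=
  ⟨{s}, Set.singleton_subset_iff.2 hs, (Set.sUnion_singleton s).symm⟩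

/-- The basis relation `r(p)` that contains the pair `p`. -/
noncomputable def basisOf (p : Ω × Ω) : X.S :=
  ⟨(X.exists_mem p).choose, (X.exists_mem p).choose_spec.1⟩

theorem mem_basisOf (p : Ω × Ω) : p ∈ (X.basisOf p).1 := (X.exists_mem p).choose_spec.2

variable {X}

theorem basisOf_eq_iff {p : Ω × Ω} {s : X.S} : X.basisOf p = s ↔ p ∈ s.1 :=
  ⟨fun h => h ▸ X.mem_basisOf p,
    fun h => Subtype.ext (X.eq_of_mem (X.basisOf p).2 s.2 (X.mem_basisOf p) h)⟩

theorem basisOf_eq_basisOf_iff {p p' : Ω × Ω} :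
    X.basisOf p = X.basisOf p' ↔ X.toSetoid p p' :=
  ⟨fun h => ⟨_, (X.basisOf p').2, basisOf_eq_iff.1 h, X.mem_basisOf p'⟩,
    fun ⟨s, hs, hp, hp'⟩ => (basisOf_eq_iff (s := ⟨s, hs⟩).2 hp).trans
      (basisOf_eq_iff (s := ⟨s, hs⟩).2 hp').symm⟩

theorem eq_of_toSetoid_diagonal {a b c : Ω} (h : X.toSetoid (a, a) (b, c)) : b = c :=
  X.mem_relations_iff.1 X.diagonal_mem_relations _ _ h rfl

variable [Finite Ω]

theorem pathCount_ne_zero_iff {R R' : Set (Ω × Ω)} {p : Ω × Ω} :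
    pathCount R R' p ≠ 0 ↔ ∃ c, (p.1, c) ∈ R ∧ (c, p.2) ∈ R' := by
  rw [pathCount, ← Nat.pos_iff_ne_zero, Set.ncard_pos]
  rfl

theorem comp_mem_relations {R R' : Set (Ω × Ω)} (hR : R ∈ X.relations) (hR' : R' ∈ X.relations) :
    {p : Ω × Ω | ∃ c, (p.1, c) ∈ R ∧ (c, p.2) ∈ R'} ∈ X.relations := by
  simp only [mem_relations_iff, Set.mem_ofPred_eq, ← pathCount_ne_zero_iff]
  intro p p' h hp
  rwa [← X.pathCount_congr hR hR' h]

theorem exists_toSetoid_of_toSetoid {a b a' b' : Ω} (h : X.toSetoid (a, b) (a', b')) (c : Ω) :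
    ∃ c', X.toSetoid (a, c) (a', c') ∧ X.toSetoid (c, b) (c', b') := by
  have hcomp := comp_mem_relations (X.mem_relations_of_mem (X.basisOf (a, c)).2)
    (X.mem_relations_of_mem (X.basisOf (c, b)).2)
  obtain ⟨c', hac', hcb'⟩ := X.mem_relations_iff.1 hcomp _ _ h
    ⟨c, X.mem_basisOf (a, c), X.mem_basisOf (c, b)⟩
  exact ⟨c', basisOf_eq_basisOf_iff.1 (basisOf_eq_iff.2 hac').symm,
    basisOf_eq_basisOf_iff.1 (basisOf_eq_iff.2 hcb').symm⟩

theorem sum_intersectionNumber [Fintype X.S] (t : X.S) :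
    ∑ rs : X.S × X.S, X.intersectionNumber rs.1 rs.2 t = Nat.card Ω := by
  obtain ⟨p, hp⟩ := X.nonempty_of_mem t.2
  let g : Ω → X.S × X.S := fun c => (X.basisOf (p.1, c), X.basisOf (c, p.2))
  rw [← Nat.card_congr (Equiv.sigmaFiberEquiv g), Nat.card_sigma]
  refine Finset.sum_congr rfl fun rs _ => ?_
  rw [← X.pathCount_eq_intersectionNumber rs.1 rs.2 t hp, pathCount, ← Nat.card_coe_set_eq]
  exact Nat.card_congr (Equiv.subtypeEquivRight fun c => by
    simp [g, Prod.ext_iff, basisOf_eq_iff])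

end Relations

namespace AlgIso

variable {Ω Ω' : Type*} {X : CoherentConfiguration Ω} {X' : CoherentConfiguration Ω'}

/-- The inverse algebraic isomorphism. -/
def symm (φ : AlgIso X X') : AlgIso X' X where
  toEquiv := φ.toEquiv.symm
  map_intersectionNumber r s t := by simp [φ.map_intersectionNumber]

/-- The pairs `p` and `p'` correspond under `φ`: the basis relation of `p` goes to that of `p'`. -/
def Corresponds (φ : AlgIso X X') (p : Ω × Ω) (p' : Ω' × Ω') : Prop :=
  φ.toEquiv (X.basisOf p) = X'.basisOf p'

variable {φ : AlgIso X X'}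

theorem Corresponds.symm {p : Ω × Ω} {p' : Ω' × Ω'} (h : φ.Corresponds p p') :
    φ.symm.Corresponds p' p :=
  φ.toEquiv.symm_apply_eq.2 (Eq.symm h)

theorem exists_corresponds (φ : AlgIso X X') (p : Ω × Ω) : ∃ p', φ.Corresponds p p' := by
  obtain ⟨p', hp'⟩ := X'.nonempty_of_mem (φ.toEquiv (X.basisOf p)).2
  exact ⟨p', (basisOf_eq_iff.2 hp').symm⟩

theorem Corresponds.congr_left {p q : Ω × Ω} {p' : Ω' × Ω'} (h : φ.Corresponds p p')
    (hpq : X.toSetoid p q) : φ.Corresponds q p' := by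
  rwa [Corresponds, ← basisOf_eq_basisOf_iff.2 hpq]

theorem Corresponds.toSetoid_left {p q : Ω × Ω} {p' : Ω' × Ω'} (hp : φ.Corresponds p p')
    (hq : φ.Corresponds q p') : X.toSetoid p q :=
  basisOf_eq_basisOf_iff.1 (φ.toEquiv.injective (Eq.trans hp (Eq.symm hq)))

theorem Corresponds.toSetoid_right {p : Ω × Ω} {p' q' : Ω' × Ω'} (hp : φ.Corresponds p p')
    (hq : φ.Corresponds p q') : X'.toSetoid p' q' :=
  basisOf_eq_basisOf_iff.1 ((Eq.symm hp).trans hq)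

variable [Finite Ω] [Finite Ω']

theorem Corresponds.forth {a b : Ω} {a' b' : Ω'} (h : φ.Corresponds (a, b) (a', b')) (c : Ω) :
    ∃ c', φ.Corresponds (a, c) (a', c') ∧ φ.Corresponds (c, b) (c', b') := by
  have hne : X.intersectionNumber (X.basisOf (a, c)) (X.basisOf (c, b)) (X.basisOf (a, b)) ≠ 0 := by
    rw [← X.pathCount_eq_intersectionNumber _ _ _ (X.mem_basisOf (a, b)), pathCount_ne_zero_iff]
    exact ⟨c, X.mem_basisOf (a, c), X.mem_basisOf (c, b)⟩
  rw [φ.map_intersectionNumber, h,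
    ← X'.pathCount_eq_intersectionNumber _ _ _ (X'.mem_basisOf (a', b')),
    pathCount_ne_zero_iff] at hne
  obtain ⟨c', hac', hcb'⟩ := hne
  exact ⟨c', (basisOf_eq_iff.2 hac').symm, (basisOf_eq_iff.2 hcb').symm⟩

theorem Corresponds.back {a b : Ω} {a' b' : Ω'} (h : φ.Corresponds (a, b) (a', b')) (c' : Ω') :
    ∃ c, φ.Corresponds (a, c) (a', c') ∧ φ.Corresponds (c, b) (c', b') := by
  obtain ⟨c, hac, hcb⟩ := h.symm.forth c'
  exact ⟨c, hac.symm, hcb.symm⟩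

theorem Corresponds.eq_of_diagonal {a : Ω} {a' b' : Ω'} (h : φ.Corresponds (a, a) (a', b')) :
    a' = b' := by
  obtain ⟨c, hac, hca⟩ := h.back a'
  obtain rfl : c = a := eq_of_toSetoid_diagonal (h.toSetoid_left hca)
  exact eq_of_toSetoid_diagonal (hac.toSetoid_right h)

theorem Corresponds.eq_iff {a b : Ω} {a' b' : Ω'} (h : φ.Corresponds (a, b) (a', b')) :
    a = b ↔ a' = b' := by
  constructor
  · rintro rfl
    exact h.eq_of_diagonal
  · rintro rfl
    exact h.symm.eq_of_diagonal

theorem card_eq (φ : AlgIso X X') : Nat.card Ω = Nat.card Ω' := by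
  have := Fintype.ofFinite X.S
  have := Fintype.ofFinite X'.S
  by_cases hS : Nonempty X.S
  · obtain ⟨t⟩ := hS
    rw [← sum_intersectionNumber t, ← sum_intersectionNumber (φ.toEquiv t),
      ← (φ.toEquiv.prodCongr φ.toEquiv).sum_comp]
    exact Finset.sum_congr rfl fun rs _ => φ.map_intersectionNumber _ _ _
  · have : IsEmpty Ω := ⟨fun a => hS ⟨X.basisOf (a, a)⟩⟩
    have : IsEmpty Ω' := ⟨fun a => hS ⟨φ.toEquiv.symm (X'.basisOf (a, a))⟩⟩
    simp

theorem exists_isInducedBy_of_corresponds {f : Ω → Ω'}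
    (hf : ∀ a b, φ.Corresponds (a, b) (f a, f b)) : ∃ g : Ω ≃ Ω', φ.IsInducedBy g := by
  have hbij : Function.Bijective f :=
    Function.Injective.bijective_of_nat_card_le (fun a b h => (hf a b).eq_iff.2 h) φ.card_eq.ge
  refine ⟨Equiv.ofBijective f hbij, fun s => ?_⟩
  ext ⟨a', b'⟩
  obtain ⟨a, rfl⟩ := hbij.surjective a'
  obtain ⟨b, rfl⟩ := hbij.surjective b'
  have himage : (f a, f b) ∈ Prod.map f f '' s.1 ↔ (a, b) ∈ s.1 :=
    (hbij.injective.prodMap hbij.injective).mem_set_image (a := (a, b))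
  rw [Equiv.coe_ofBijective, himage, ← basisOf_eq_iff, ← basisOf_eq_iff, ← hf a b,
    φ.toEquiv.injective.eq_iff]

/-- The case of a rank-two configuration, where every bijection preserves the relations. -/
theorem exists_isInducedBy_of_rank_two
    (hdiag : ∀ a b : Ω, X.toSetoid (a, a) (b, b))
    (hoff : ∀ a b a' b' : Ω, a ≠ b → a' ≠ b' → X.toSetoid (a, b) (a', b')) (φ : AlgIso X X') :
    ∃ f : Ω ≃ Ω', φ.IsInducedBy f := by
  obtain ⟨f⟩ := (Finite.card_eq (α := Ω) (β := Ω')).1 φ.card_eq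
  refine exists_isInducedBy_of_corresponds (f := f) fun a b => ?_
  obtain ⟨⟨c, d⟩, hcd⟩ := φ.symm.exists_corresponds (f a, f b)
  refine hcd.symm.congr_left ?_
  have heq : c = d ↔ a = b := hcd.eq_iff.symm.trans f.injective.eq_iff
  by_cases hab : a = b
  · obtain rfl := heq.2 hab
    exact hab ▸ hdiag c a
  · exact hoff c d a b (mt heq.1 hab) hab

end AlgIso

/-! ### Points determined in an extension -/

section Extension

variable {Ω : Type*} [Finite Ω] {X : CoherentConfiguration Ω} {m : ℕ}

theorem tensorRel_mem_relations (s : Fin m → X.S) :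
    tensorRel (fun i => (s i).1) ∈ (X.extension m).relations :=
  (WL_isLeast _).1 (Or.inl ⟨s, rfl⟩)

theorem toSetoid_apply {p p' : (Fin m → Ω) × (Fin m → Ω)} (h : (X.extension m).toSetoid p p')
    (i : Fin m) : X.toSetoid (p.1 i, p.2 i) (p'.1 i, p'.2 i) := by
  have htensor := mem_relations_iff _ |>.1
    (tensorRel_mem_relations fun j => X.basisOf (p.1 j, p.2 j)) p p' h
    fun j => X.mem_basisOf (p.1 j, p.2 j)
  exact basisOf_eq_basisOf_iff.1 (basisOf_eq_iff.2 (htensor i)).symm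

theorem apply_mem_relations {R : Set (Ω × Ω)} (hR : R ∈ X.relations) (i : Fin m) :
    {p : (Fin m → Ω) × (Fin m → Ω) | (p.1 i, p.2 i) ∈ R} ∈ (X.extension m).relations :=
  (mem_relations_iff _).2 fun _ _ h => X.mem_relations_iff.1 hR _ _ (toSetoid_apply h i)

theorem apply_apply_mem_relations {R : Set (Ω × Ω)} (hR : R ∈ X.relations) (i j : Fin m) :
    {p : (Fin m → Ω) × (Fin m → Ω) | (p.1 i, p.2 j) ∈ R} ∈ (X.extension m).relations := by
  -- Move from `x` to the constant tuple `x i` and from there to `y`.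
  convert comp_mem_relations (apply_mem_relations X.diagonal_mem_relations i)
    (comp_mem_relations ((WL_isLeast _).1 (Or.inr rfl) : diagRel Ω m ∈ (X.extension m).relations)
      (apply_mem_relations hR j)) using 1
  ext ⟨x, y⟩
  constructor
  · exact fun h => ⟨fun _ => x i, rfl, fun _ => x i, ⟨rfl, x i, rfl⟩, h⟩
  · rintro ⟨c, hx : x i = c i, c', ⟨hcc' : c = c', a, hc : c = _⟩, h : (c' j, y j) ∈ R⟩
    rw [← hcc', hc] at h
    change (x i, y j) ∈ R
    rwa [hx, hc]

variable (X) in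
/-- Over the points `x₁, …, x_m`, the `m`-extension distinguishes two points `δ, ε` by means of
coordinate `i` if the pairs formed by `x` and the tuples obtained from `x` by putting `δ` or `ε`
in place of `x_i` lie in different basis relations. This is the complementary relation. -/
def indist (x : Fin m → Ω) (i : Fin m) : Setoid Ω :=
  (X.extension m).toSetoid.comap fun δ => (x, Function.update x i δ)

variable (X) in
/-- The point `w` is determined by `x₁, …, x_m`: the `m`-extension distinguishes it from all other
points by means of coordinate `i`. -/
def Determined (x : Fin m → Ω) (i : Fin m) (w : Ω) : Prop :=
  ∀ w', X.indist x i w w' → w' = w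

variable {x : Fin m → Ω} {i : Fin m}

theorem determined_apply (j : Fin m) : X.Determined x i (x j) := fun w' h => by
  have hij := (mem_relations_iff _).1 (apply_apply_mem_relations X.diagonal_mem_relations j i)
    _ _ h (by simp)
  simpa using Eq.symm hij

theorem eq_update_of_toSetoid {δ : Ω} {z : Fin m → Ω}
    (h : (X.extension m).toSetoid (x, Function.update x i δ) (x, z)) :
    z = Function.update x i (z i) := by
  refine Function.eq_update_iff.2 ⟨rfl, fun j hj => ?_⟩
  have hj' := toSetoid_apply h j
  simp only [Function.update_of_ne hj] at hj'
  exact (eq_of_toSetoid_diagonal hj').symm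

theorem Determined.eq_update_of_toSetoid {w : Ω} {z : Fin m → Ω} (hw : X.Determined x i w)
    (h : (X.extension m).toSetoid (x, Function.update x i w) (x, z)) :
    z = Function.update x i w := by
  have hz := CoherentConfiguration.eq_update_of_toSetoid h
  rw [hz] at h ⊢
  rw [hw _ h]

theorem toSetoid_of_determined {δ ε w : Ω} (h : X.indist x i δ ε) (hw : X.Determined x i w) :
    X.toSetoid (w, δ) (w, ε) := by
  obtain ⟨z, hxz, hz⟩ := exists_toSetoid_of_toSetoid h (Function.update x i w)
  rw [hw.eq_update_of_toSetoid hxz] at hz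
  simpa using toSetoid_apply hz i

/-- The partition into classes of indistinguishable points is equitable. -/
theorem ncard_eq_of_indist {δ ε : Ω} (h : X.indist x i δ ε) {W : Set Ω}
    (hW : ∀ w ∈ W, ∀ w', X.indist x i w w' → w' ∈ W) {R : Set (Ω × Ω)} (hR : R ∈ X.relations) :
    {w ∈ W | (w, δ) ∈ R}.ncard = {w ∈ W | (w, ε) ∈ R}.ncard := by
  set U : Set ((Fin m → Ω) × (Fin m → Ω)) :=
    {p | ∃ w ∈ W, (X.extension m).toSetoid (x, Function.update x i w) p}
  have hU : U ∈ (X.extension m).relations := by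
    refine (mem_relations_iff _).2 ?_
    rintro p p' hp ⟨w, hw, hwp⟩
    exact ⟨w, hw, (X.extension m).toSetoid.trans hwp hp⟩
  have hpath (η : Ω) : {w ∈ W | (w, η) ∈ R}.ncard =
      pathCount U {p | (p.1 i, p.2 i) ∈ R} (x, Function.update x i η) := by
    refine Set.ncard_congr (fun w _ => Function.update x i w) ?_ ?_ ?_
    · rintro w ⟨hw, hwη⟩
      exact ⟨⟨w, hw, (X.extension m).toSetoid.refl _⟩, by simpa using hwη⟩
    · exact fun _ _ _ _ => fun h => Function.update_injective x i h
    · rintro z ⟨⟨w, hw, hwz⟩, hz⟩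
      have hzi := eq_update_of_toSetoid hwz
      rw [hzi] at hwz
      exact ⟨z i, ⟨hW w hw _ hwz, by simpa using hz⟩, hzi.symm⟩
  rw [hpath, hpath]
  exact (X.extension m).pathCount_congr hU (apply_mem_relations hR i) h

theorem AlgIso.Corresponds.apply {Ω' : Type*} [Finite Ω'] {X' : CoherentConfiguration Ω'}
    {φ : AlgIso X X'} {ψ : AlgIso (X.extension m) (X'.extension m)}
    (hψ : ∀ s : Fin m → X.S, ψ.mapRel (tensorRel fun i => (s i).1) =
      tensorRel fun i => (φ.toEquiv (s i)).1)
    {p : (Fin m → Ω) × (Fin m → Ω)} {p' : (Fin m → Ω') × (Fin m → Ω')}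
    (h : ψ.Corresponds p p') (i : Fin m) :
    φ.Corresponds (p.1 i, p.2 i) (p'.1 i, p'.2 i) := by
  have hsub : ((X.extension m).basisOf p).1 ⊆ tensorRel fun j => (X.basisOf (p.1 j, p.2 j)).1 :=
    fun q hq => (mem_relations_iff _).1 (tensorRel_mem_relations _) p q
      (basisOf_eq_basisOf_iff.1 (basisOf_eq_iff.2 hq).symm) fun j => X.mem_basisOf _
  have hmem : p' ∈ ψ.mapRel (tensorRel fun j => (X.basisOf (p.1 j, p.2 j)).1) :=
    ⟨_, hsub, basisOf_eq_iff.1 (Eq.symm h)⟩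
  rw [hψ] at hmem
  exact (basisOf_eq_iff.2 (hmem i)).symm

theorem isDeterminedBy_of_determined (h : ∀ w, X.Determined x i w) : X.IsDeterminedBy m := by
  rintro Ω' _ X' φ ⟨ψ, hψ, -⟩
  obtain ⟨⟨x', _⟩, hx⟩ := ψ.exists_corresponds (x, x)
  obtain rfl := hx.eq_of_diagonal
  choose z hz _ using fun w => hx.forth (Function.update x i w)
  refine AlgIso.exists_isInducedBy_of_corresponds (f := fun w => z w i) fun v w => ?_
  obtain ⟨y, hxy, hyw⟩ := (hz w).back (z v)
  rw [(h v).eq_update_of_toSetoid ((hz v).toSetoid_left hxy)] at hyw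
  simpa using hyw.apply hψ i

theorem separabilityNumber_le (hm : 0 < m) (h : X.IsDeterminedBy m) :
    X.separabilityNumber ≤ m :=
  sInf_le ⟨m, hm, h, rfl⟩

end Extension

/-! ### Three points that determine all points -/

section Counting

open Finset

theorem exists_card_filter_le_of_card_le {ι κ : Type*} [Fintype ι] [Nonempty ι] {T : Finset κ}
    (r : ι → κ → Prop) [∀ i t, Decidable (r i t)] {b M : ℕ}
    (hT : #T ≤ Fintype.card ι * b)
    (hM : ∀ t ∈ T, #{i | r i t} ≤ M) : ∃ i, #{t ∈ T | r i t} ≤ b * M := by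
  obtain ⟨i, -, hi⟩ := exists_le_of_sum_le (s := univ) univ_nonempty
    (f := fun i => #{t ∈ T | r i t}) (g := fun _ : ι => b * M) <|
    calc ∑ i, #{t ∈ T | r i t}
        = ∑ t ∈ T, #{i | r i t} := sum_card_bipartiteAbove_eq_sum_card_bipartiteBelow r
      _ ≤ #T * M := sum_le_card_nsmul T _ M hM
      _ ≤ Fintype.card ι * b * M := Nat.mul_le_mul_right M hT
      _ = ∑ _i : ι, b * M := by simp [mul_assoc]
  exact ⟨i, hi⟩

variable {Ω : Type*} [Finite Ω] {X : CoherentConfiguration Ω} {M b : ℕ} {α β : Ω}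

/-- The number of pairs of distinct points that are not distinguished by `α` and `β` is at most
`b |Ω|`, and on average at most `b M` of these pairs are not distinguished by a third point. -/
theorem exists_lt_ncard_isolated
    (hM : ∀ δ ε, δ ≠ ε → {w | X.toSetoid (w, δ) (w, ε)}.ncard ≤ M)
    (hb : ∀ δ, {ε | X.toSetoid (α, δ) (α, ε) ∧ X.toSetoid (β, δ) (β, ε)}.ncard ≤ b)
    (hn : b * M + M < Nat.card Ω) :
    ∃ γ, M < {δ | ∀ ε, (∀ j, X.toSetoid (![α, β, γ] j, δ) (![α, β, γ] j, ε)) → ε = δ}.ncard := by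
  classical
  have := Fintype.ofFinite Ω
  have : Nonempty Ω := ⟨α⟩
  rw [Nat.card_eq_fintype_card] at hn
  simp only [Set.ncard_eq_toFinset_card', Set.toFinset_ofPred] at hM hb ⊢
  let T : Finset (Σ _ : Ω, Ω) := univ.sigma fun δ =>
    {ε | ε ≠ δ ∧ X.toSetoid (α, δ) (α, ε) ∧ X.toSetoid (β, δ) (β, ε)}
  have hT : #T ≤ Fintype.card Ω * b := by
    rw [card_sigma]
    exact sum_le_card_nsmul _ _ _ fun δ _ =>
      (card_le_card (monotone_filter_right _ fun _ _ h => h.2)).trans (hb δ)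
  obtain ⟨γ, hγ⟩ := exists_card_filter_le_of_card_le
    (fun γ (p : Σ _ : Ω, Ω) => X.toSetoid (γ, p.1) (γ, p.2)) hT fun p hp =>
      hM p.1 p.2 (by simpa [T] using fun h => (mem_filter.1 (mem_sigma.1 hp).2).2.1 h.symm)
  refine ⟨γ, ?_⟩
  set I : Finset Ω := {δ | ∀ ε, (∀ j, X.toSetoid (![α, β, γ] j, δ) (![α, β, γ] j, ε)) → ε = δ}
  have hcompl : Iᶜ ⊆ image Sigma.fst {p ∈ T | X.toSetoid (γ, p.1) (γ, p.2)} := by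
    intro δ hδ
    simp only [I, mem_compl, mem_filter_univ, not_forall] at hδ
    obtain ⟨ε, hε, hne⟩ := hδ
    exact mem_image.2 ⟨⟨δ, ε⟩, mem_filter.2
      ⟨mem_sigma.2 ⟨mem_univ δ, mem_filter.2 ⟨mem_univ ε, hne, hε 0, hε 1⟩⟩, hε 2⟩, rfl⟩
  have hcard := (card_le_card hcompl).trans (card_image_le.trans hγ)
  rw [card_compl] at hcard
  omega

theorem isDeterminedBy_three_of_ncard_le
    (hM : ∀ δ ε, δ ≠ ε → {w | X.toSetoid (w, δ) (w, ε)}.ncard ≤ M)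
    (hb : ∀ δ, {ε | X.toSetoid (α, δ) (α, ε) ∧ X.toSetoid (β, δ) (β, ε)}.ncard ≤ b)
    (hn : b * M + M < Nat.card Ω) : X.IsDeterminedBy 3 := by
  obtain ⟨γ, hγ⟩ := exists_lt_ncard_isolated hM hb hn
  refine isDeterminedBy_of_determined (x := ![α, β, γ]) (i := 2) fun δ ε hδε => ?_
  by_contra hne
  refine (hM δ ε (Ne.symm hne)).not_gt (hγ.trans_le (Set.ncard_le_ncard fun w hw => ?_))
  exact toSetoid_of_determined hδε fun w' hw' =>
    hw w' fun j => toSetoid_of_determined hw' (determined_apply j)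

end Counting

end CoherentConfiguration

/-! ### Finite fields of characteristic two -/

section FiniteField

theorem mem_range_algebraMap_of_fixed {F K : Type*} [Field F] [Field K] [Algebra F K]
    (hp : (Module.finrank F K).Prime) {σ : K ≃ₐ[F] K} (hσ : σ ≠ AlgEquiv.refl) {x : K}
    (hx : σ x = x) : x ∈ Set.range (algebraMap F K) := by
  have := Subalgebra.isSimpleOrder_of_finrank_prime F K hp
  rcases eq_bot_or_eq_top (AlgHom.equalizer (σ : K →ₐ[F] K) (AlgHom.id F K)) with h | h
  · rw [← Algebra.mem_bot, ← h]
    exact hx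
  · exact absurd (AlgEquiv.ext fun y => AlgHom.congr_fun (AlgHom.equalizer_eq_top.1 h) y) hσ

theorem exists_algEquiv_zmod {K : Type*} [Field K] (n : ℕ) [Algebra (ZMod n) K] (σ : K ≃+* K) :
    ∃ τ : K ≃ₐ[ZMod n] K, (τ : K ≃+* K) = σ :=
  ⟨AlgEquiv.ofRingEquiv (f := σ) (RingHom.congr_fun (Subsingleton.elim
    ((σ : K →+* K).comp (algebraMap (ZMod n) K)) (algebraMap (ZMod n) K))), rfl⟩

theorem charP_of_card {K : Type*} [Field K] [Finite K] {p d : ℕ} [Fact p.Prime]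
    (hK : Nat.card K = p ^ d) : CharP K p := by
  have := Fintype.ofFinite K
  exact charP_of_card_eq_prime_pow (Nat.card_eq_fintype_card.symm.trans hK)

variable {K : Type*} [Field K]

theorem finrank_zmod_of_card [Finite K] {p d : ℕ} [Fact p.Prime] [Algebra (ZMod p) K]
    (hK : Nat.card K = p ^ d) : Module.finrank (ZMod p) K = d := by
  have h := Module.natCard_eq_pow_finrank (K := ZMod p) (V := K)
  rw [hK, Nat.card_zmod] at h
  exact (Nat.pow_right_injective (Fact.out : p.Prime).two_le h).symm

theorem card_ringEquiv_le [Finite K] {p d : ℕ} [Fact p.Prime] (hK : Nat.card K = p ^ d) :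
    Nat.card (K ≃+* K) ≤ d := by
  have := charP_of_card hK
  let _ := ZMod.algebra K p
  refine (Nat.card_le_card_of_surjective _ (exists_algEquiv_zmod (K := K) p)).trans ?_
  rw [Nat.card_eq_fintype_card, ← finrank_zmod_of_card hK]
  exact AlgEquiv.card_le

theorem eq_zero_or_one_of_fixed [Finite K] {d : ℕ} (hd : d.Prime) (hK : Nat.card K = 2 ^ d)
    {σ : K ≃+* K} (hσ : σ ≠ RingEquiv.refl K) {x : K} (hx : σ x = x) : x = 0 ∨ x = 1 := by
  have := charP_of_card hK
  let _ := ZMod.algebra K 2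
  obtain ⟨τ, rfl⟩ := exists_algEquiv_zmod 2 σ
  have hτ : τ ≠ AlgEquiv.refl := by
    rintro rfl
    exact hσ rfl
  obtain ⟨z, rfl⟩ := mem_range_algebraMap_of_fixed (finrank_zmod_of_card hK ▸ hd) hτ hx
  fin_cases z
  · exact .inl (map_zero _)
  · exact .inr (map_one _)

variable [CharP K 2]

/-- The Artin–Schreier map `y ↦ y² + y`. A form `a x² + x y + c y²` is anisotropic if and only if
`a c` does not lie in its range. -/
def artinSchreier (K : Type*) [Field K] [CharP K 2] : K →+ K where
  toFun y := y ^ 2 + y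
  map_zero' := by simp
  map_add' x y := by
    rw [CharTwo.add_sq]
    ring

theorem artinSchreier_apply (y : K) : artinSchreier K y = y ^ 2 + y := rfl

theorem artinSchreier_eq_iff {x y : K} :
    artinSchreier K x = artinSchreier K y ↔ x = y ∨ x = y + 1 := by
  have h2 : (2 : K) = 0 := CharTwo.two_eq_zero
  have hfactor : artinSchreier K x - artinSchreier K y = (x - y) * (x - (y + 1)) := by
    simp only [artinSchreier_apply]
    linear_combination (x - y ^ 2 + x * y - y) * h2
  rw [← sub_eq_zero, hfactor, mul_eq_zero, sub_eq_zero, sub_eq_zero]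

theorem card_ker_artinSchreier : Nat.card (artinSchreier K).ker = 2 := by
  have : ((artinSchreier K).ker : Set K) = {0, 1} := by
    ext x
    rw [SetLike.mem_coe, AddMonoidHom.mem_ker, ← map_zero (artinSchreier K), artinSchreier_eq_iff]
    simp
  rw [← SetLike.coe_sort_coe, this, Nat.card_coe_set_eq, Set.ncard_pair zero_ne_one]

theorem two_mul_card_range_artinSchreier [Finite K] :
    2 * Nat.card (artinSchreier K).range = Nat.card K := by
  rw [← AddSubgroup.index_ker, ← card_ker_artinSchreier (K := K), AddSubgroup.card_mul_index]

theorem index_range_artinSchreier [Finite K] : (artinSchreier K).range.index = 2 :=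
  Nat.eq_of_mul_eq_mul_left Nat.card_pos <| by
    rw [AddSubgroup.card_mul_index, mul_comm, two_mul_card_range_artinSchreier]

theorem one_notMem_range_artinSchreier [Finite K] {d : ℕ} (hd : Odd d)
    (hK : Nat.card K = 2 ^ d) : (1 : K) ∉ (artinSchreier K).range := by
  rintro ⟨y, hy⟩
  have h2 : (2 : K) = 0 := CharTwo.two_eq_zero
  rw [artinSchreier_apply] at hy
  have hy4 : y ^ 2 ^ 2 = y := by grind
  have hy4k : ∀ k, y ^ (2 ^ 2) ^ k = y := fun k => by
    induction k with
    | zero => simp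
    | succ k ih => rw [pow_succ, pow_mul, ih, hy4]
  have hyq : y ^ Nat.card K = y := by
    have := Fintype.ofFinite K
    rw [Nat.card_eq_fintype_card, FiniteField.pow_card]
  obtain ⟨k, rfl⟩ := hd
  have hy2 : y ^ 2 = y := by rwa [hK, pow_succ, pow_mul, pow_mul, hy4k] at hyq
  rw [hy2, CharTwo.add_self_eq_zero] at hy
  exact zero_ne_one hy

end FiniteField


/-! ### Points of the small Hollmann scheme and their normalized forms -/

namespace IsSemilinear

variable {K V : Type*} [Field K] [AddCommGroup V] [Module K V] {f : V ≃+ V} {σ : K ≃+* K}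

theorem symm (hf : IsSemilinear K f σ) : IsSemilinear K f.symm σ.symm := fun c v => by
  apply f.injective
  rw [hf]
  simp

/-- The quadratic form `σ ∘ Q ∘ f⁻¹`. -/
def mapForm (hf : IsSemilinear K f σ) (Q : QuadraticForm K V) : QuadraticForm K V :=
  have hpolar (v w : V) : QuadraticMap.polar (fun v => σ (Q (f.symm v))) v w =
      σ (QuadraticMap.polar Q (f.symm v) (f.symm w)) := by
    simp only [QuadraticMap.polar, map_add, map_sub]
  QuadraticMap.ofPolar (fun v => σ (Q (f.symm v)))
    (fun c v => by
      rw [hf.symm, QuadraticMap.map_smul]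
      simp)
    (fun u v w => by simp only [hpolar, map_add, QuadraticMap.polar_add_left])
    (fun c v w => by
      rw [hpolar, hpolar, hf.symm, QuadraticMap.polar_smul_left]
      simp)

theorem mapForm_apply (hf : IsSemilinear K f σ) (Q : QuadraticForm K V) (v : V) :
    hf.mapForm Q v = σ (Q (f.symm v)) := rfl

theorem anisotropic_mapForm (hf : IsSemilinear K f σ) {Q : QuadraticForm K V}
    (hQ : Q.Anisotropic) : (hf.mapForm Q).Anisotropic := fun v hv => by
  rw [mapForm_apply, map_eq_zero] at hv
  simpa using hQ _ hv

end IsSemilinear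

namespace HollmannPoint

section Field

variable {K : Type*} [Field K]

theorem ext_rep {P R : HollmannPoint K} (k : K) (h : ∀ v, P.1.rep v = k * R.1.rep v) : P = R := by
  apply Subtype.ext
  rw [← P.1.mk_rep, ← R.1.mk_rep, Projectivization.mk_eq_mk_iff']
  exact ⟨k, QuadraticMap.ext fun v => (h v).symm⟩

theorem exists_rep_eq {Q : QuadraticForm K (Fin 2 → K)} (hQ : Q.Anisotropic) :
    ∃ (P : HollmannPoint K) (u : Kˣ), ∀ v, P.1.rep v = u * Q v := by
  have hQ0 : Q ≠ 0 := by
    rintro rfl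
    simpa using congrFun (hQ ![1, 0] rfl) 0
  obtain ⟨u, hu⟩ := Projectivization.exists_smul_eq_mk_rep K Q hQ0
  have hrep : ∀ v, (Projectivization.mk K Q hQ0).rep v = u * Q v := fun v => by
    rw [← hu]
    rfl
  refine ⟨⟨Projectivization.mk K Q hQ0, fun v hv => hQ v ?_⟩, u, hrep⟩
  rw [hrep] at hv
  simpa using hv

theorem exists_mem_PGammaL {f : (Fin 2 → K) ≃+ (Fin 2 → K)} {σ : K ≃+* K}
    (hf : IsSemilinear K f σ) : ∃ π ∈ PGammaL K, ∀ P : HollmannPoint K, ∃ u : Kˣ,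
      ∀ v, (π P).1.rep v = u * σ (P.1.rep (f.symm v)) := by
  choose m u hm using fun P : HollmannPoint K => exists_rep_eq (hf.anisotropic_mapForm P.2)
  choose m' u' hm' using fun P : HollmannPoint K => exists_rep_eq (hf.symm.anisotropic_mapForm P.2)
  simp only [IsSemilinear.mapForm_apply, AddEquiv.symm_symm] at hm hm'
  let π : Equiv.Perm (HollmannPoint K) :=
    { toFun := m
      invFun := m'
      left_inv := fun P => ext_rep (u' (m P) * σ.symm (u P)) fun v => by
        rw [hm', hm, map_mul, σ.symm_apply_apply, f.symm_apply_apply, mul_assoc]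
      right_inv := fun P => ext_rep (u (m' P) * σ (u' P)) fun v => by
        rw [hm, hm', map_mul, σ.apply_symm_apply, f.apply_symm_apply, mul_assoc] }
  exact ⟨π, ⟨f, σ, hf, fun P => ⟨u P, hm P⟩⟩, fun P => ⟨u P, hm P⟩⟩

theorem form_apply_eq (Q : QuadraticForm K (Fin 2 → K)) (v : Fin 2 → K) :
    Q v = Q ![1, 0] * v 0 ^ 2 + QuadraticMap.polar Q ![1, 0] ![0, 1] * (v 0 * v 1) +
      Q ![0, 1] * v 1 ^ 2 := by
  have hv : v = v 0 • ![1, 0] + v 1 • ![0, 1] := by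
    funext i
    fin_cases i <;> simp
  conv_lhs => rw [hv, QuadraticMap.map_add Q]
  rw [QuadraticMap.map_smul, QuadraticMap.map_smul, QuadraticMap.polar_smul_left,
    QuadraticMap.polar_smul_right]
  simp only [smul_eq_mul]
  ring

/-- The coefficient of `xy` in the chosen representative of `P`. -/
noncomputable def middle (P : HollmannPoint K) : K :=
  QuadraticMap.polar P.1.rep ![1, 0] ![0, 1]

/-- The coefficient of `x²` in the representative `a x² + xy + c y²` of `P`, which exists in
characteristic two. -/
noncomputable def a (P : HollmannPoint K) : K := P.1.rep ![1, 0] / P.middle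

/-- The coefficient of `y²` in the representative `a x² + xy + c y²` of `P`. -/
noncomputable def c (P : HollmannPoint K) : K := P.1.rep ![0, 1] / P.middle

/-- The value at `v` of the representative `a x² + xy + c y²` of `P`. -/
noncomputable def form (P : HollmannPoint K) (v : Fin 2 → K) : K :=
  P.a * v 0 ^ 2 + v 0 * v 1 + P.c * v 1 ^ 2

/-- The symplectic form on `K²`; in characteristic two it is the polar form of every form
`a x² + xy + c y²`. -/
def bracket (v w : Fin 2 → K) : K := v 0 * w 1 + v 1 * w 0

/-- The invariant of a pair of points: the orbits of the linear group on pairs of points are its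
level sets. -/
noncomputable def inv (P R : HollmannPoint K) : K :=
  (P.a * R.c + R.a * P.c) ^ 2 + (P.a + R.a) * (P.c + R.c)

theorem inv_comm (P R : HollmannPoint K) : P.inv R = R.inv P := by
  simp only [inv]
  ring

theorem exists_bracket_eq_one {w : Fin 2 → K} (hw : w ≠ 0) : ∃ v, bracket w v = 1 := by
  obtain ⟨i, hi⟩ := Function.ne_iff.1 hw
  rw [Pi.zero_apply] at hi
  fin_cases i
  · exact ⟨![0, (w 0)⁻¹], by simpa [bracket] using mul_inv_cancel₀ hi⟩
  · exact ⟨![(w 1)⁻¹, 0], by simpa [bracket] using mul_inv_cancel₀ hi⟩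

theorem form_add [CharP K 2] (P : HollmannPoint K) (v w : Fin 2 → K) :
    P.form (v + w) = P.form v + P.form w + bracket v w := by
  have h2 : (2 : K) = 0 := CharTwo.two_eq_zero
  simp only [form, bracket, Pi.add_apply]
  linear_combination (P.a * v 0 * w 0 + P.c * v 1 * w 1) * h2

end Field

section PerfectField

variable {K : Type*} [Field K] [CharP K 2] [PerfectRing K 2] {P R : HollmannPoint K}

theorem exists_sq_eq (x : K) : ∃ y, y ^ 2 = x :=
  surjective_frobenius K 2 x

theorem middle_ne_zero (P : HollmannPoint K) : P.middle ≠ 0 := by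
  intro hm
  obtain ⟨x, hx⟩ := exists_sq_eq (P.1.rep ![0, 1])
  obtain ⟨y, hy⟩ := exists_sq_eq (P.1.rep ![1, 0])
  have hxy : P.1.rep ![x, y] = 0 := by
    rw [form_apply_eq, ← middle, hm, ← hx, ← hy]
    simp [mul_comm, CharTwo.add_self_eq_zero]
  have hx0 : x = 0 := congrFun (P.2 _ hxy) 0
  have h01 := P.2 ![0, 1] (by rw [← hx, hx0, zero_pow two_ne_zero])
  exact one_ne_zero (congrFun h01 1)

theorem rep_apply (P : HollmannPoint K) (v : Fin 2 → K) : P.1.rep v = P.middle * P.form v := by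
  have hm := P.middle_ne_zero
  rw [form_apply_eq, ← middle, form, a, c]
  field_simp

theorem eq_zero_of_form_eq_zero {v : Fin 2 → K} (hv : P.form v = 0) : v = 0 :=
  P.2 v (by rw [rep_apply, hv, mul_zero])

theorem a_ne_zero (P : HollmannPoint K) : P.a ≠ 0 := fun h =>
  one_ne_zero (congrFun (eq_zero_of_form_eq_zero (P := P) (v := ![1, 0]) (by simp [form, h])) 0)

theorem ext_coord (ha : P.a = R.a) (hc : P.c = R.c) : P = R :=
  ext_rep (P.middle / R.middle) fun v => by
    have := R.middle_ne_zero
    rw [P.rep_apply, R.rep_apply, form, form, ha, hc]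
    field_simp

theorem polar_rep (P : HollmannPoint K) (v w : Fin 2 → K) :
    QuadraticMap.polar P.1.rep v w = P.middle * bracket v w := by
  rw [QuadraticMap.polar, P.rep_apply, P.rep_apply, P.rep_apply, form_add]
  ring

theorem coord_of_rep_eq {σ : K ≃+* K} {f : (Fin 2 → K) ≃+ (Fin 2 → K)} {u : Kˣ}
    (hu : ∀ v, R.1.rep v = u * σ (P.1.rep (f.symm v))) {p r : Fin 2 → K}
    (hp : f.symm ![1, 0] = p) (hr : f.symm ![0, 1] = r) :
    bracket p r ≠ 0 ∧ R.a = σ (P.form p / bracket p r) ∧ R.c = σ (P.form r / bracket p r) := by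
  have hmiddle : R.middle = u * σ (P.middle * bracket p r) := by
    rw [← P.polar_rep, middle, QuadraticMap.polar, hu, hu, hu, ← mul_sub, ← mul_sub, ← map_sub,
      ← map_sub, map_add, hp, hr, QuadraticMap.polar]
  have hR := R.middle_ne_zero
  have hσP : σ P.middle ≠ 0 := (map_ne_zero σ).2 P.middle_ne_zero
  have hpr : bracket p r ≠ 0 := by
    intro h
    rw [hmiddle, h, mul_zero, map_zero, mul_zero] at hR
    exact hR rfl
  have hσ : σ (bracket p r) ≠ 0 := (map_ne_zero σ).2 hpr
  refine ⟨hpr, ?_, ?_⟩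
  · rw [a, hmiddle, hu, P.rep_apply, hp, map_div₀, map_mul, map_mul]
    field_simp
  · rw [c, hmiddle, hu, P.rep_apply, hr, map_div₀, map_mul, map_mul]
    field_simp

end PerfectField

end HollmannPoint


/-! ### The action of the group on points -/

namespace HollmannPoint

section Field

variable {K : Type*} [Field K]

theorem toSetoid_iff {p p' : HollmannPoint K × HollmannPoint K} :
    (smallHollmannScheme K).toSetoid p p' ↔ ∃ π ∈ PGammaL K, π p.1 = p'.1 ∧ π p.2 = p'.2 := by
  constructor
  · rintro ⟨_, ⟨x, rfl⟩, ⟨g, rfl⟩, ⟨g', rfl⟩⟩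
    refine ⟨(g' * g⁻¹ : PGammaL K), SetLike.coe_mem _, ?_⟩
    simp [Subgroup.smul_def]
  · rintro ⟨π, hπ, h₁, h₂⟩
    exact ⟨_, ⟨p, rfl⟩, MulAction.mem_orbit_self _, ⟨⟨π, hπ⟩, Prod.ext h₁ h₂⟩⟩

/-- The quadratic form `x X² + X Y + y Y²`. -/
def normalForm (x y : K) : QuadraticForm K (Fin 2 → K) :=
  x • QuadraticMap.proj 0 0 + QuadraticMap.proj 0 1 + y • QuadraticMap.proj 1 1

theorem normalForm_apply (x y : K) (v : Fin 2 → K) :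
    normalForm x y v = x * v 0 ^ 2 + v 0 * v 1 + y * v 1 ^ 2 := by
  simp [normalForm, QuadraticMap.proj_apply, sq]

variable [CharP K 2]

/-- The semilinear bijection with companion automorphism `σ` whose inverse takes the standard basis
to `p, r`. -/
def ofBasis (σ : K ≃+* K) {p r : Fin 2 → K} (hpr : bracket p r = 1) :
    (Fin 2 → K) ≃+ (Fin 2 → K) where
  toFun v := ![σ (bracket v r), σ (bracket p v)]
  invFun v := σ.symm (v 0) • p + σ.symm (v 1) • r
  left_inv v := by
    have h2 : (2 : K) = 0 := CharTwo.two_eq_zero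
    rw [bracket] at hpr
    funext i
    fin_cases i <;> simp [bracket] <;> grind
  right_inv v := by
    have h2 : (2 : K) = 0 := CharTwo.two_eq_zero
    rw [bracket] at hpr
    have h₀ : bracket (σ.symm (v 0) • p + σ.symm (v 1) • r) r = σ.symm (v 0) := by
      simp only [bracket, Pi.add_apply, Pi.smul_apply, smul_eq_mul]
      grind
    have h₁ : bracket p (σ.symm (v 0) • p + σ.symm (v 1) • r) = σ.symm (v 1) := by
      simp only [bracket, Pi.add_apply, Pi.smul_apply, smul_eq_mul]
      grind
    funext i
    fin_cases i <;> simp [h₀, h₁]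
  map_add' v w := by
    funext i
    fin_cases i <;> simp [bracket] <;> ring

theorem isSemilinear_ofBasis (σ : K ≃+* K) {p r : Fin 2 → K} (hpr : bracket p r = 1) :
    IsSemilinear K (ofBasis σ hpr) σ := fun k v => by
  funext i
  fin_cases i <;> simp [ofBasis, bracket] <;> ring

theorem anisotropic_normalForm {x y : K} (h : x * y ∉ (artinSchreier K).range) :
    (normalForm x y).Anisotropic := by
  have h2 : (2 : K) = 0 := CharTwo.two_eq_zero
  intro v hv
  rw [normalForm_apply] at hv
  have hx : x ≠ 0 := by
    rintro rfl
    exact h (by simp)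
  have hv₁ : v 1 = 0 := by
    by_contra hv₁
    refine h ⟨x * (v 0 / v 1), ?_⟩
    rw [artinSchreier_apply]
    field_simp
    linear_combination hv - y * v 1 ^ 2 * h2
  have hv₀ : v 0 = 0 := by simpa [hv₁, hx] using hv
  funext i
  fin_cases i
  exacts [hv₀, hv₁]

theorem exists_coord {x y : K} (h : x * y ∉ (artinSchreier K).range) :
    ∃ P : HollmannPoint K, P.a = x ∧ P.c = y := by
  obtain ⟨P, u, hP⟩ := exists_rep_eq (anisotropic_normalForm h)
  have hm : P.middle = u := by
    simp only [middle, QuadraticMap.polar, hP, normalForm_apply]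
    simp
    ring
  exact ⟨P, by simp [a, hm, hP, normalForm_apply], by simp [c, hm, hP, normalForm_apply]⟩

end Field

section PerfectField

variable {K : Type*} [Field K] [CharP K 2] [PerfectRing K 2]

theorem exists_mem_PGammaL_coord (σ : K ≃+* K) {p r : Fin 2 → K} (hpr : bracket p r = 1) :
    ∃ π ∈ PGammaL K, ∀ P : HollmannPoint K,
      (π P).a = σ (P.form p) ∧ (π P).c = σ (P.form r) := by
  obtain ⟨π, hπ, H⟩ := exists_mem_PGammaL (isSemilinear_ofBasis σ hpr)
  refine ⟨π, hπ, fun P => ?_⟩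
  obtain ⟨u, hu⟩ := H P
  obtain ⟨-, ha, hc⟩ := coord_of_rep_eq hu (p := p) (r := r) (by simp [ofBasis])
    (by simp [ofBasis])
  rw [hpr, div_one] at ha hc
  exact ⟨ha, hc⟩

theorem exists_mem_PGammaL_map (σ : K ≃+* K) :
    ∃ π ∈ PGammaL K, ∀ P : HollmannPoint K, (π P).a = σ P.a ∧ (π P).c = σ P.c := by
  obtain ⟨π, hπ, H⟩ := exists_mem_PGammaL_coord σ (p := ![1, 0]) (r := ![0, 1]) (by simp [bracket])
  exact ⟨π, hπ, by simpa [form] using H⟩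

theorem exists_inv_map_eq {π : Equiv.Perm (HollmannPoint K)} (hπ : π ∈ PGammaL K) :
    ∃ σ : K ≃+* K, ∀ P R : HollmannPoint K, (π P).inv (π R) = σ (P.inv R) := by
  have : (2 : K) = 0 := CharTwo.two_eq_zero
  obtain ⟨f, σ, -, H⟩ := hπ
  refine ⟨σ, fun P R => ?_⟩
  obtain ⟨u, hu⟩ := H P
  obtain ⟨u', hu'⟩ := H R
  obtain ⟨hpr, hPa, hPc⟩ := coord_of_rep_eq hu rfl rfl
  obtain ⟨-, hRa, hRc⟩ := coord_of_rep_eq hu' rfl rfl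
  rw [inv, hPa, hPc, hRa, hRc]
  simp only [← map_mul, ← map_add, ← map_pow]
  congr 1
  simp only [inv, form, bracket] at hpr ⊢
  field_simp
  grind

theorem exists_inv_eq_of_toSetoid {P R P' R' : HollmannPoint K}
    (h : (smallHollmannScheme K).toSetoid (P, R) (P', R')) :
    ∃ σ : K ≃+* K, P'.inv R' = σ (P.inv R) := by
  obtain ⟨π, hπ, rfl, rfl⟩ := toSetoid_iff.1 h
  obtain ⟨σ, hσ⟩ := exists_inv_map_eq hπ
  exact ⟨σ, hσ P R⟩

/-- In characteristic two the difference of two normalized forms is additive and semilinear, hence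
the square of a linear form. -/
theorem exists_form_eq_add_bracket_sq (P R : HollmannPoint K) :
    ∃ w, (∀ v, R.form v = P.form v + bracket w v ^ 2) ∧ P.inv R = P.form w ^ 2 := by
  have : (2 : K) = 0 := CharTwo.two_eq_zero
  obtain ⟨x, hx⟩ := exists_sq_eq (P.c + R.c)
  obtain ⟨y, hy⟩ := exists_sq_eq (P.a + R.a)
  refine ⟨![x, y], fun v => ?_, ?_⟩
  · simp only [form, bracket, Matrix.cons_val_zero, Matrix.cons_val_one]
    grind
  · simp only [inv, form, Matrix.cons_val_zero, Matrix.cons_val_one]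
    grind

theorem inv_eq_zero_iff {P R : HollmannPoint K} : P.inv R = 0 ↔ P = R := by
  constructor
  · intro h
    obtain ⟨w, hw, hinv⟩ := exists_form_eq_add_bracket_sq P R
    obtain rfl : w = 0 := eq_zero_of_form_eq_zero (pow_eq_zero_iff two_ne_zero |>.1 (hinv ▸ h))
    exact ext_coord (by simpa [form, bracket] using (hw ![1, 0]).symm)
      (by simpa [form, bracket] using (hw ![0, 1]).symm)
  · rintro rfl
    simp [inv, CharTwo.add_self_eq_zero]

theorem form_mul_form_notMem_range (P : HollmannPoint K) {w v : Fin 2 → K}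
    (hwv : bracket w v = 1) : P.form w * P.form v ∉ (artinSchreier K).range := by
  rintro ⟨z, hz⟩
  have h2 : (2 : K) = 0 := CharTwo.two_eq_zero
  rw [artinSchreier_apply] at hz
  have hzero : P.form (z • w + P.form w • v) = 0 := by
    rw [form_add]
    simp only [form, bracket, Pi.smul_apply, smul_eq_mul] at hwv hz ⊢
    grind
  have h0 := eq_zero_of_form_eq_zero hzero
  have hw : P.form w = 0 :=
    calc P.form w = bracket w (z • w + P.form w • v) := by
          simp only [bracket, Pi.add_apply, Pi.smul_apply, smul_eq_mul] at hwv ⊢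
          linear_combination -P.form w * hwv - z * w 0 * w 1 * h2
      _ = 0 := by rw [h0]; simp [bracket]
  rw [eq_zero_of_form_eq_zero hw] at hwv
  simp [bracket] at hwv

theorem a_mul_c_notMem_range (P : HollmannPoint K) : P.a * P.c ∉ (artinSchreier K).range := by
  simpa [form] using P.form_mul_form_notMem_range (w := ![1, 0]) (v := ![0, 1]) (by simp [bracket])

end PerfectField

section FiniteField

variable {K : Type*} [Field K] [CharP K 2] [Finite K]

theorem exists_bracket_eq_one_and_form_eq (P : HollmannPoint K) {w : Fin 2 → K} {e : K}
    (he : P.form w * e ∉ (artinSchreier K).range) : ∃ v, bracket w v = 1 ∧ P.form v = e := by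
  have h2 : (2 : K) = 0 := CharTwo.two_eq_zero
  have hw : P.form w ≠ 0 := fun h => he (by simp [h])
  obtain ⟨v, hv⟩ := exists_bracket_eq_one (w := w) (by
    rintro rfl
    simp [form] at hw)
  obtain ⟨z, hz⟩ : P.form w * P.form v + P.form w * e ∈ (artinSchreier K).range := by
    rw [AddSubgroup.add_mem_iff_of_index_two index_range_artinSchreier]
    exact iff_of_false (P.form_mul_form_notMem_range hv) he
  refine ⟨v + (z / P.form w) • w, ?_, ?_⟩
  · simp only [bracket, Pi.add_apply, Pi.smul_apply, smul_eq_mul] at hv ⊢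
    linear_combination hv + z / P.form w * w 0 * w 1 * h2
  · rw [artinSchreier_apply] at hz
    have hsmul : P.form ((z / P.form w) • w) = z ^ 2 / P.form w := by
      rw [div_eq_mul_inv z]
      simp only [form, Pi.smul_apply, smul_eq_mul] at hw ⊢
      field_simp
    have hbracket : bracket v ((z / P.form w) • w) = z / P.form w := by
      simp only [bracket, Pi.smul_apply, smul_eq_mul] at hv ⊢
      linear_combination z / P.form w * hv
    rw [form_add, hsmul, hbracket]
    field_simp
    linear_combination hz + P.form w * P.form v * h2

/-- A standard position for pairs of points: any two pairs with the same invariant can be moved to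
the same pair. -/
theorem exists_mem_PGammaL_standard {P R : HollmannPoint K} {s e : K} (hs : P.inv R = s ^ 2)
    (he : s * e ∉ (artinSchreier K).range) :
    ∃ π ∈ PGammaL K, ((π P).a = s ∧ (π P).c = e) ∧ ((π R).a = s ∧ (π R).c = e + 1) := by
  obtain ⟨w, hw, hinv⟩ := exists_form_eq_add_bracket_sq P R
  obtain rfl : P.form w = s := CharTwo.sq_injective (hinv.symm.trans hs)
  obtain ⟨v, hwv, rfl⟩ := P.exists_bracket_eq_one_and_form_eq he
  obtain ⟨π, hπ, H⟩ := exists_mem_PGammaL_coord (RingEquiv.refl K) hwv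
  refine ⟨π, hπ, H P, (H R).1.trans ?_, (H R).2.trans ?_⟩
  · simp [hw, bracket, mul_comm, CharTwo.add_self_eq_zero]
  · simp [hw, hwv]

theorem exists_mem_PGammaL_of_inv_eq {P R P' R' : HollmannPoint K} (hPR : P ≠ R)
    (h : P.inv R = P'.inv R') : ∃ π ∈ PGammaL K, π P = P' ∧ π R = R' := by
  obtain ⟨s, hs⟩ := exists_sq_eq (P.inv R)
  have hs0 : s ≠ 0 := by
    rintro rfl
    exact hPR (inv_eq_zero_iff.1 (by simp [← hs]))
  have he : s * (P.a * P.c / s) ∉ (artinSchreier K).range := by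
    rw [mul_div_cancel₀ _ hs0]
    exact P.a_mul_c_notMem_range
  obtain ⟨π, hπ, ⟨h₁, h₂⟩, h₃, h₄⟩ := exists_mem_PGammaL_standard hs.symm he
  obtain ⟨π', hπ', ⟨h₁', h₂'⟩, h₃', h₄'⟩ := exists_mem_PGammaL_standard (h.symm.trans hs.symm) he
  refine ⟨π'⁻¹ * π, mul_mem (inv_mem hπ') hπ, ?_, ?_⟩
  · rw [Equiv.Perm.mul_apply, Equiv.Perm.inv_eq_iff_eq]
    exact ext_coord (h₁.trans h₁'.symm) (h₂.trans h₂'.symm)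
  · rw [Equiv.Perm.mul_apply, Equiv.Perm.inv_eq_iff_eq]
    exact ext_coord (h₃.trans h₃'.symm) (h₄.trans h₄'.symm)

theorem inv_mem_range (P R : HollmannPoint K) : P.inv R ∈ (artinSchreier K).range := by
  have : (2 : K) = 0 := CharTwo.two_eq_zero
  have hac : P.a * P.c + R.a * R.c ∈ (artinSchreier K).range := by
    rw [AddSubgroup.add_mem_iff_of_index_two index_range_artinSchreier]
    exact iff_of_false P.a_mul_c_notMem_range R.a_mul_c_notMem_range
  have hinv : P.inv R = artinSchreier K (P.a * R.c + R.a * P.c) + (P.a * P.c + R.a * R.c) := by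
    rw [inv, artinSchreier_apply]
    ring
  rw [hinv]
  exact add_mem ⟨_, rfl⟩ hac

end FiniteField

end HollmannPoint


/-! ### Counting points -/

theorem ncard_le_mul_ncard_of_mapsTo {α β : Type*} [Finite α] [Finite β] {s : Set α} {t : Set β}
    {f : α → β} {n : ℕ} (hf : Set.MapsTo f s t) (hn : ∀ y ∈ t, {x ∈ s | f x = y}.ncard ≤ n) :
    s.ncard ≤ n * t.ncard := by
  classical
  have := Fintype.ofFinite α
  have := Fintype.ofFinite β
  simp only [Set.ncard_eq_toFinset_card'] at hn ⊢
  refine Finset.card_le_mul_card_image_of_maps_to (f := f) (fun x hx => ?_) n fun y hy => ?_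
  · exact Set.mem_toFinset.2 (hf (Set.mem_toFinset.1 hx))
  · convert hn y (Set.mem_toFinset.1 hy) using 2
    ext
    simp

theorem ncard_exists_le {α ι : Type*} [Finite ι] {p : ι → α → Prop} {n : ℕ}
    (h : ∀ i, {x | p i x}.ncard ≤ n) : {x | ∃ i, p i x}.ncard ≤ Nat.card ι * n := by
  have := Fintype.ofFinite ι
  calc {x | ∃ i, p i x}.ncard = (⋃ i, {x | p i x}).ncard := by rw [Set.ofPred_exists]
    _ ≤ ∑ i, {x | p i x}.ncard := Set.ncard_iUnion_le_of_fintype _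
    _ ≤ ∑ _i : ι, n := Finset.sum_le_sum fun i _ => h i
    _ = Nat.card ι * n := by simp

theorem lt_two_pow_of_seventeen_le {d : ℕ} (hd : 17 ≤ d) : 16 * d ^ 3 + 4 * d + 1 < 2 ^ d := by
  induction d, hd using Nat.le_induction with
  | base => norm_num
  | succ d hd ih =>
    have h₁ : 17 * d ≤ d ^ 2 := by nlinarith
    have h₂ : 17 * d ^ 2 ≤ d ^ 3 := by nlinarith
    calc 16 * (d + 1) ^ 3 + 4 * (d + 1) + 1
        = 16 * d ^ 3 + 48 * d ^ 2 + 52 * d + 21 := by ring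
      _ < 2 * (16 * d ^ 3 + 4 * d + 1) := by omega
      _ ≤ 2 ^ (d + 1) := by omega

namespace HollmannPoint

/-- Twice the oriented area of the triangle `P R D` in the affine plane of the forms
`a x² + xy + c y²`. -/
noncomputable def area {K : Type*} [Field K] (P R D : HollmannPoint K) : K :=
  (D.a + P.a) * (R.c + P.c) + (R.a + P.a) * (D.c + P.c)

section PerfectField

variable {K : Type*} [Field K] [CharP K 2]

theorem inv_add_inv (P R D : HollmannPoint K) :
    P.inv D + R.inv D = P.inv R + artinSchreier K (area P R D) := by
  have : (2 : K) = 0 := CharTwo.two_eq_zero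
  simp only [inv, area, artinSchreier_apply]
  grind

variable [PerfectRing K 2] {P R : HollmannPoint K}

theorem exists_coord_eq_add_of_area_eq (hPR : P ≠ R) {D E : HollmannPoint K}
    (harea : area P R D = area P R E) :
    ∃ t, E.a = D.a + t * (R.a + P.a) ∧ E.c = D.c + t * (R.c + P.c) := by
  have h2 : (2 : K) = 0 := CharTwo.two_eq_zero
  simp only [area] at harea
  by_cases hA : R.a + P.a = 0
  · have hC : R.c + P.c ≠ 0 := fun h => hPR <|
      ext_coord (CharTwo.add_eq_zero.1 hA).symm (CharTwo.add_eq_zero.1 h).symm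
    have hDE : D.a = E.a := by
      rw [hA, zero_mul, zero_mul, add_zero, add_zero] at harea
      exact add_right_cancel (mul_right_cancel₀ hC harea)
    refine ⟨(E.c + D.c) / (R.c + P.c), by rw [hA, hDE, mul_zero, add_zero], ?_⟩
    field_simp
    grind
  · refine ⟨(E.a + D.a) / (R.a + P.a), ?_, ?_⟩ <;> field_simp <;> grind

/-- A line parallel to `PR` meets a conic `inv P = s` in at most two points. -/
theorem ncard_area_inv_le (hPR : P ≠ R) (w s : K) :
    {D | area P R D = w ∧ P.inv D = s}.ncard ≤ 2 := by
  have : (2 : K) = 0 := CharTwo.two_eq_zero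
  rcases Set.eq_empty_or_nonempty {D | area P R D = w ∧ P.inv D = s} with h | ⟨D, rfl, rfl⟩
  · rw [h, Set.ncard_empty]
    exact Nat.zero_le _
  let shift (t : K) : K × K := (D.a + t * (R.a + P.a), D.c + t * (R.c + P.c))
  refine (Set.ncard_le_ncard_of_injOn (fun E => (E.a, E.c))
    (t := {shift 0, shift (area P R D / P.inv R)}) (fun E hE => ?_) fun E _ E' _ h => ?_).trans
      (Set.ncard_insert_le _ _ |>.trans (by rw [Set.ncard_singleton]))
  · obtain ⟨harea, hinv⟩ := hE
    obtain ⟨t, ha, hc⟩ := exists_coord_eq_add_of_area_eq hPR harea.symm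
    have hE : (E.a, E.c) = shift t := Prod.ext ha hc
    have ht : t * (t * P.inv R + area P R D) = 0 := by
      simp only [inv, ha, hc] at hinv
      simp only [inv, area]
      grind
    rcases mul_eq_zero.1 ht with rfl | ht
    · exact .inl hE
    · have hPR₀ : P.inv R ≠ 0 := fun h => hPR (inv_eq_zero_iff.1 h)
      exact .inr (hE.trans (congrArg shift ((eq_div_iff hPR₀).2 (CharTwo.add_eq_zero.1 ht))))
  · exact ext_coord (congrArg Prod.fst h) (congrArg Prod.snd h)

end PerfectField

section FiniteField

variable {K : Type*} [Field K] [CharP K 2] [Finite K] {P R : HollmannPoint K} {d : ℕ}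

theorem two_mul_card : 2 * Nat.card (HollmannPoint K) = Nat.card K * (Nat.card K - 1) := by
  let T : AddSubgroup K := (artinSchreier K).range
  have hT : 2 * (Tᶜ : Set K).ncard = Nat.card K := by
    have hrange : 2 * (T : Set K).ncard = Nat.card K := two_mul_card_range_artinSchreier
    have hcompl := Set.ncard_add_ncard_compl (T : Set K)
    omega
  let coord (P : HollmannPoint K) : Kˣ × (Tᶜ : Set K) :=
    (Units.mk0 P.a P.a_ne_zero, ⟨P.a * P.c, P.a_mul_c_notMem_range⟩)
  have hcoord : Function.Bijective coord := by
    refine ⟨fun P R h => ?_, fun ⟨x, y, hy⟩ => ?_⟩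
    · have ha : P.a = R.a := congrArg (fun p => (p.1 : K)) h
      have hac : P.a * P.c = R.a * R.c := congrArg (fun p => (p.2 : K)) h
      exact ext_coord ha (mul_left_cancel₀ R.a_ne_zero (ha ▸ hac))
    · obtain ⟨P, ha, hc⟩ := exists_coord (x := (x : K)) (y := y / x)
        (by rwa [mul_div_cancel₀ _ x.ne_zero])
      refine ⟨P, Prod.ext (Units.ext ha) (Subtype.ext ?_)⟩
      simp only [coord, ha, hc, mul_div_cancel₀ _ x.ne_zero]
  rw [Nat.card_eq_of_bijective coord hcoord, Nat.card_prod, Nat.card_units, Nat.card_coe_set_eq,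
    mul_left_comm, hT, mul_comm]

theorem ncard_inv_inv_le (hPR : P ≠ R) (s t : K) : {D | P.inv D = s ∧ R.inv D = t}.ncard ≤ 4 := by
  rcases Set.eq_empty_or_nonempty {D | P.inv D = s ∧ R.inv D = t} with h | ⟨D₀, hs, ht⟩
  · rw [h, Set.ncard_empty]
    exact Nat.zero_le _
  calc {D | P.inv D = s ∧ R.inv D = t}.ncard
      ≤ 2 * ({area P R D₀, area P R D₀ + 1} : Set K).ncard :=
        ncard_le_mul_ncard_of_mapsTo (f := area P R) (fun D ⟨hs', ht'⟩ => ?_) fun w _ =>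
          (Set.ncard_le_ncard (t := {D | area P R D = w ∧ P.inv D = s}) fun _ hD =>
            ⟨hD.2, hD.1.1⟩).trans (ncard_area_inv_le hPR w s)
    _ ≤ 2 * 2 := Nat.mul_le_mul_left 2 (by simp)
  have h := inv_add_inv P R D
  rw [hs', ht', ← hs, ← ht, inv_add_inv] at h
  exact artinSchreier_eq_iff.1 (add_left_cancel h).symm

theorem ncard_inv_eq_inv_le (hPR : P ≠ R) : {D | R.inv D = P.inv D}.ncard ≤ 2 * Nat.card K :=
  calc {D | R.inv D = P.inv D}.ncard
      ≤ 4 * ((artinSchreier K).range : Set K).ncard :=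
        ncard_le_mul_ncard_of_mapsTo (f := P.inv) (fun D _ => P.inv_mem_range D) fun s _ =>
          (Set.ncard_le_ncard (t := {D | P.inv D = s ∧ R.inv D = s}) fun _ hD =>
            ⟨hD.2, hD.1.trans hD.2⟩).trans (ncard_inv_inv_le hPR s s)
    _ = 2 * (2 * Nat.card (artinSchreier K).range) := by
        rw [← Nat.card_coe_set_eq, SetLike.coe_sort_coe]
        ring
    _ = 2 * Nat.card K := by rw [two_mul_card_range_artinSchreier]

/-- On a line parallel to `PR`, the equation `inv R D = σ (inv P D)` determines `inv P D` up to a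
fixed point of `σ`, that is, up to `1`, which is not a difference of invariants. -/
theorem ncard_inv_eq_map_inv_le_of_ne_refl (hd : d.Prime) (hodd : Odd d)
    (hK : Nat.card K = 2 ^ d) (hPR : P ≠ R) {σ : K ≃+* K} (hσ : σ ≠ RingEquiv.refl K) :
    {D | R.inv D = σ (P.inv D)}.ncard ≤ 2 * Nat.card K := by
  rw [← Set.ncard_univ]
  refine ncard_le_mul_ncard_of_mapsTo (f := area P R) (Set.mapsTo_univ _ _) fun w _ => ?_
  rcases Set.eq_empty_or_nonempty {D ∈ {D | R.inv D = σ (P.inv D)} | area P R D = w} with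
    h | ⟨D₀, hD₀, hw₀⟩
  · rw [h, Set.ncard_empty]
    exact Nat.zero_le _
  refine (Set.ncard_le_ncard fun D hD => ?_).trans (ncard_area_inv_le hPR w (P.inv D₀))
  obtain ⟨hD, hw⟩ := hD
  have hsum : P.inv D + σ (P.inv D) = P.inv D₀ + σ (P.inv D₀) := by
    rw [← show R.inv D = σ (P.inv D) from hD, ← show R.inv D₀ = σ (P.inv D₀) from hD₀,
      inv_add_inv, inv_add_inv, hw, hw₀]
  have hfixed : σ (P.inv D - P.inv D₀) = P.inv D - P.inv D₀ := by
    have : (2 : K) = 0 := CharTwo.two_eq_zero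
    rw [map_sub]
    grind
  refine ⟨hw, sub_eq_zero.1 ((eq_zero_or_one_of_fixed hd hK hσ hfixed).resolve_right fun h => ?_)⟩
  exact one_notMem_range_artinSchreier hodd hK
    (h ▸ sub_mem (P.inv_mem_range D) (P.inv_mem_range D₀))

theorem ncard_inv_eq_map_inv_le (hd : d.Prime) (hodd : Odd d) (hK : Nat.card K = 2 ^ d)
    (hPR : P ≠ R) (σ : K ≃+* K) : {D | R.inv D = σ (P.inv D)}.ncard ≤ 2 * Nat.card K := by
  rcases eq_or_ne σ (RingEquiv.refl K) with rfl | hσ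
  · exact ncard_inv_eq_inv_le hPR
  · exact ncard_inv_eq_map_inv_le_of_ne_refl hd hodd hK hPR hσ

instance : Finite (K ≃+* K) := DFunLike.finite _

theorem ncard_toSetoid_le (hd : d.Prime) (hodd : Odd d) (hK : Nat.card K = 2 ^ d) (hPR : P ≠ R) :
    {D | (smallHollmannScheme K).toSetoid (D, P) (D, R)}.ncard ≤ d * (2 * Nat.card K) :=
  calc {D | (smallHollmannScheme K).toSetoid (D, P) (D, R)}.ncard
      ≤ {D | ∃ σ : K ≃+* K, R.inv D = σ (P.inv D)}.ncard := Set.ncard_le_ncard fun D hD => by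
        simpa only [Set.mem_ofPred_eq, inv_comm _ D] using exists_inv_eq_of_toSetoid hD
    _ ≤ Nat.card (K ≃+* K) * (2 * Nat.card K) :=
        ncard_exists_le (ncard_inv_eq_map_inv_le hd hodd hK hPR)
    _ ≤ d * (2 * Nat.card K) := Nat.mul_le_mul_right _ (card_ringEquiv_le hK)

theorem ncard_toSetoid_toSetoid_le (hK : Nat.card K = 2 ^ d) (hPR : P ≠ R) (D : HollmannPoint K) :
    {E | (smallHollmannScheme K).toSetoid (P, D) (P, E) ∧
      (smallHollmannScheme K).toSetoid (R, D) (R, E)}.ncard ≤ 4 * d ^ 2 :=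
  calc {E | (smallHollmannScheme K).toSetoid (P, D) (P, E) ∧
        (smallHollmannScheme K).toSetoid (R, D) (R, E)}.ncard
      ≤ {E | ∃ σ : (K ≃+* K) × (K ≃+* K),
          P.inv E = σ.1 (P.inv D) ∧ R.inv E = σ.2 (R.inv D)}.ncard :=
        Set.ncard_le_ncard fun E ⟨hP, hR⟩ => by
          obtain ⟨σ, hσ⟩ := exists_inv_eq_of_toSetoid hP
          obtain ⟨τ, hτ⟩ := exists_inv_eq_of_toSetoid hR
          exact ⟨(σ, τ), hσ, hτ⟩
    _ ≤ Nat.card ((K ≃+* K) × (K ≃+* K)) * 4 :=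
        ncard_exists_le fun _ => ncard_inv_inv_le hPR _ _
    _ ≤ d * d * 4 := by
        rw [Nat.card_prod]
        gcongr <;> exact card_ringEquiv_le hK
    _ = 4 * d ^ 2 := by ring

theorem isDeterminedBy_of_seventeen_le (hd : d.Prime) (hd17 : 17 ≤ d) (hK : Nat.card K = 2 ^ d) :
    (smallHollmannScheme K).IsDeterminedBy 3 := by
  have hlarge : 4 * d ^ 2 * (d * (2 * Nat.card K)) + d * (2 * Nat.card K) <
      Nat.card (HollmannPoint K) := by
    have hcard : 2 * Nat.card (HollmannPoint K) = Nat.card K * (Nat.card K - 1) := two_mul_card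
    have hmul : Nat.card K * (16 * d ^ 3 + 4 * d) < Nat.card K * (Nat.card K - 1) :=
      Nat.mul_lt_mul_of_pos_left
        (Nat.lt_sub_of_add_lt (hK ▸ lt_two_pow_of_seventeen_le hd17)) Nat.card_pos
    nlinarith
  obtain ⟨P, R, hPR⟩ : ∃ P R : HollmannPoint K, P ≠ R :=
    have := Finite.one_lt_card_iff_nontrivial.1 (show 1 < Nat.card (HollmannPoint K) by
      have : 0 < d * (2 * Nat.card K) :=
        Nat.mul_pos hd.pos (Nat.mul_pos two_pos Nat.card_pos)
      omega)
    exists_pair_ne _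
  exact CoherentConfiguration.isDeterminedBy_three_of_ncard_le
    (fun _ _ => ncard_toSetoid_le hd (hd.odd_of_ne_two (by omega)) hK)
    (ncard_toSetoid_toSetoid_le hK hPR) hlarge

end FiniteField

end HollmannPoint



/-! ### Degree eight -/

theorem cubic_of_mem_range_artinSchreier {K : Type*} [Field K] [CharP K 2]
    (hK : Nat.card K = 2 ^ 3) {x : K} (hx : x ∈ (artinSchreier K).range) (hx0 : x ≠ 0) :
    x ^ 3 + x + 1 = 0 := by
  have : (2 : K) = 0 := CharTwo.two_eq_zero
  have : Finite K := Nat.finite_of_card_ne_zero (by simp [hK])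
  have := Fintype.ofFinite K
  obtain ⟨y, rfl⟩ := hx
  rw [artinSchreier_apply] at hx0 ⊢
  have hy : y ^ 8 = y := by
    simpa [← Nat.card_eq_fintype_card, hK] using FiniteField.pow_card y
  apply mul_left_cancel₀ hx0
  grind

theorem exists_ringEquiv_apply_eq_of_cubic {K : Type*} [Field K] [CharP K 2] [PerfectRing K 2]
    {x y : K} (hx : x ^ 3 + x + 1 = 0) (hy : y ^ 3 + y + 1 = 0) : ∃ σ : K ≃+* K, σ x = y := by
  have : (2 : K) = 0 := CharTwo.two_eq_zero
  have hroots : (y - x) * ((y - x ^ 2) * (y - (x ^ 2) ^ 2)) = 0 := by grind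
  simp only [mul_eq_zero, sub_eq_zero] at hroots
  rcases hroots with rfl | rfl | rfl
  · exact ⟨RingEquiv.refl K, rfl⟩
  · exact ⟨frobeniusEquiv K 2, rfl⟩
  · exact ⟨(frobeniusEquiv K 2).trans (frobeniusEquiv K 2), rfl⟩

namespace HollmannPoint

variable {K : Type*} [Field K] [CharP K 2] [Finite K]

theorem exists_mem_PGammaL_of_card_eight (hK : Nat.card K = 2 ^ 3) {P R P' R' : HollmannPoint K}
    (hPR : P ≠ R) (hPR' : P' ≠ R') : ∃ π ∈ PGammaL K, π P = P' ∧ π R = R' := by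
  have cubic {P R : HollmannPoint K} (h : P ≠ R) : P.inv R ^ 3 + P.inv R + 1 = 0 :=
    cubic_of_mem_range_artinSchreier hK (P.inv_mem_range R) (inv_eq_zero_iff.not.2 h)
  obtain ⟨σ, hσ⟩ := exists_ringEquiv_apply_eq_of_cubic (cubic hPR) (cubic hPR')
  obtain ⟨π, hπ, hmap⟩ := exists_mem_PGammaL_map σ
  have hinv : (π P).inv (π R) = P'.inv R' := by
    rw [← hσ]
    simp only [inv, (hmap _).1, (hmap _).2, map_add, map_mul, map_pow]
  obtain ⟨π', hπ', hP, hR⟩ := exists_mem_PGammaL_of_inv_eq (π.injective.ne hPR) hinv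
  exact ⟨π' * π, mul_mem hπ' hπ, hP, hR⟩

theorem isDeterminedBy_of_card_eight (hK : Nat.card K = 2 ^ 3) :
    (smallHollmannScheme K).IsDeterminedBy 3 := by
  have : Nontrivial (HollmannPoint K) := by
    have hcard : 2 * Nat.card (HollmannPoint K) = Nat.card K * (Nat.card K - 1) := two_mul_card
    rw [hK] at hcard
    exact Finite.one_lt_card_iff_nontrivial.1 (by omega)
  intro Ω' _ X' φ _
  refine CoherentConfiguration.AlgIso.exists_isInducedBy_of_rank_two (fun P R => toSetoid_iff.2 ?_)
    (fun P R P' R' h h' => toSetoid_iff.2 (exists_mem_PGammaL_of_card_eight hK h h')) φ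
  obtain ⟨P', hP'⟩ := exists_ne P
  obtain ⟨R', hR'⟩ := exists_ne R
  obtain ⟨π, hπ, h, -⟩ := exists_mem_PGammaL_of_card_eight hK hP'.symm hR'.symm
  exact ⟨π, hπ, h, h⟩

end HollmannPoint

/-! ### Degree thirty-two -/

theorem exists_forall_eq_pow_two_pow {K : Type*} [Field K] [Finite K] [CharP K 2] (σ : K ≃+* K) :
    ∃ j, ∀ x, σ x = x ^ 2 ^ j := by
  let _ := ZMod.algebra K 2
  obtain ⟨τ, rfl⟩ := exists_algEquiv_zmod 2 σ
  obtain ⟨j, rfl⟩ := (FiniteField.bijective_frobeniusAlgEquivOfAlgebraic_pow (ZMod 2) K).2 τ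
  refine ⟨j, fun x => ?_⟩
  simp [AlgEquiv.coe_pow, FiniteField.coe_frobeniusAlgEquivOfAlgebraic_iterate]

theorem pow_thirty_two_eq_self_of_quintic {R : Type*} [CommRing R] (h2 : (2 : R) = 0) {x : R}
    (hx : x ^ 5 = x ^ 2 + 1) : x ^ 32 = x := by
  have h8 : x ^ 8 = x ^ 3 + x ^ 2 + 1 := by grind
  have h16 : x ^ 16 = x ^ 4 + x ^ 3 + x + 1 :=
    calc x ^ 16 = (x ^ 8) ^ 2 := by ring
      _ = (x ^ 3 + x ^ 2 + 1) ^ 2 := by rw [h8]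
      _ = x ^ 4 + x ^ 3 + x + 1 := by grind
  calc x ^ 32 = (x ^ 16) ^ 2 := by ring
    _ = (x ^ 4 + x ^ 3 + x + 1) ^ 2 := by rw [h16]
    _ = x := by grind

open Polynomial in
theorem exists_quintic_root {K : Type*} [Field K] [CharP K 2] (hK : Nat.card K = 2 ^ 5) :
    ∃ θ : K, θ ^ 5 = θ ^ 2 + 1 := by
  let P : K[X] := X ^ 5 - (X ^ 2 + 1)
  have hdegree : P.degree = 5 := by
    simp only [P]
    compute_degree!
  have hdvd : P ∣ X ^ 32 - X := by
    have h2 : (2 : AdjoinRoot P) = 0 := by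
      rw [← map_ofNat (AdjoinRoot.of P) 2, CharTwo.two_eq_zero, map_zero]
    have hroot : AdjoinRoot.mk P P = 0 := AdjoinRoot.mk_self
    simp only [P, map_sub, map_add, map_pow, map_one, sub_eq_zero] at hroot
    rw [← AdjoinRoot.mk_eq_zero, map_sub, map_pow, sub_eq_zero]
    exact pow_thirty_two_eq_self_of_quintic h2 hroot
  have hsplits : P.Splits := by
    refine Splits.of_dvd ?_ (FiniteField.X_pow_card_sub_X_ne_zero K (p := 32) (by norm_num)) hdvd
    simpa [hK] using splits_X_pow_nat_card_sub_X (K := K)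
  obtain ⟨θ, hθ⟩ := hsplits.exists_eval_eq_zero (by simp [hdegree])
  exact ⟨θ, by simpa [P, sub_eq_zero] using hθ⟩

namespace GF32

/-- The code of `θ ^ n`, where `θ ^ 5 = θ ^ 2 + 1` and the code of an element of `𝔽₃₂` is the number
whose binary digits are its coordinates with respect to the powers of `θ`. The table covers
`n < 62`, so that two discrete logarithms can be added without reduction; beyond it, the value
is `0`. -/
def exp (n : ℕ) : ℕ :=
  0x1209160b17191e0f15180c0603131b1f1d1c0e07111a0d140a051008040201 * (256 ^ 31 + 1) /
    256 ^ n % 256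

/-- The discrete logarithm to the base `θ` of the element with code `a`. The choice `log 0 = 62`
makes all products by zero fall outside the table of `exp`. -/
def log (a : ℕ) : ℕ :=
  0xf180e0d100919151a1c1607111e0a04170c08141b061d030b1305021201003e / 256 ^ a % 256

/-- Multiplication of codes. Their addition is `^^^`. -/
def mul (a b : ℕ) : ℕ := exp (log a + log b)

/-- The number of the conjugacy class of an element of `𝔽₃₂` in terms of its code: `1`, `2`, `3` for
the classes of nonzero elements of trace zero, and `0` otherwise. -/
def conjClass (a : ℕ) : ℕ := 0x30201020020203013010303002010100 / 16 ^ a % 4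

/-- The code of the invariant of the points whose coordinates have the codes `p` and `r`. -/
def pairCode (p r : ℕ × ℕ) : ℕ :=
  mul (mul p.1 r.2 ^^^ mul r.1 p.2) (mul p.1 r.2 ^^^ mul r.1 p.2) ^^^
    mul (p.1 ^^^ r.1) (p.2 ^^^ r.2)

/-- The codes of the coordinates of the points. -/
def points : List (ℕ × ℕ) :=
  (List.range 32 ×ˢ List.range 32).filter fun p => mul p.1 p.2 ≠ 0 ∧ conjClass (mul p.1 p.2) = 0

theorem exp_lt {n : ℕ} (hn : n < 256) : exp n < 32 := by
  revert n
  decide +kernel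

theorem exp_of_lt_five {n : ℕ} (hn : n < 5) : exp n = 2 ^ n := by
  revert n
  decide +kernel

theorem exp_add_five {n : ℕ} (hn : n < 57) : exp (n + 5) = exp (n + 2) ^^^ exp n := by
  revert n
  decide +kernel

theorem exp_log {a : ℕ} (ha : a < 32) (ha0 : a ≠ 0) : exp (log a) = a := by
  revert a
  decide +kernel

theorem log_lt {a : ℕ} (ha : a < 32) (ha0 : a ≠ 0) : log a < 31 := by
  revert a
  decide +kernel

theorem log_le {a : ℕ} (ha : a < 32) : log a ≤ 62 := by
  revert a
  decide +kernel

theorem zero_mul {a : ℕ} (ha : a < 32) : mul 0 a = 0 := by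
  revert a
  decide +kernel

theorem mul_zero {a : ℕ} (ha : a < 32) : mul a 0 = 0 := by
  revert a
  decide +kernel

theorem xor_lt {a b : ℕ} (ha : a < 32) (hb : b < 32) : a ^^^ b < 32 :=
  Nat.xor_lt_two_pow (n := 5) ha hb

theorem mul_lt {a b : ℕ} (ha : a < 32) (hb : b < 32) : mul a b < 32 :=
  exp_lt (by have := log_le ha; have := log_le hb; omega)

theorem conjClass_mul_self {a : ℕ} (ha : a < 32) : conjClass (mul a a) = conjClass a := by
  revert a
  decide +kernel

theorem exists_mul_self_xor_eq_iff {a : ℕ} (ha : a < 32) :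
    (∃ b < 32, mul b b ^^^ b = a) ↔ (a ≠ 0 → conjClass a ≠ 0) := by
  revert a
  decide +kernel

theorem conjClass_lt (a : ℕ) : conjClass a < 4 := Nat.mod_lt _ (by norm_num)

theorem mem_points {p : ℕ × ℕ} :
    p ∈ points ↔ p.1 < 32 ∧ p.2 < 32 ∧ mul p.1 p.2 ≠ 0 ∧ conjClass (mul p.1 p.2) = 0 := by
  obtain ⟨a, c⟩ := p
  simp [points, and_assoc]

theorem pairCode_lt {p r : ℕ × ℕ} (hp : p ∈ points) (hr : r ∈ points) : pairCode p r < 32 := by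
  obtain ⟨hp₁, hp₂, -⟩ := mem_points.1 hp
  obtain ⟨hr₁, hr₂, -⟩ := mem_points.1 hr
  have h := xor_lt (mul_lt hp₁ hr₂) (mul_lt hr₁ hp₂)
  exact xor_lt (mul_lt h h) (mul_lt (xor_lt hp₁ hr₁) (xor_lt hp₂ hr₂))

section Decode

variable {K : Type*} [Field K]

/-- The element with code `n`. -/
def decode (θ : K) (n : ℕ) : K := ∑ i ∈ Finset.range 5, if n.testBit i then θ ^ i else 0

theorem decode_zero (θ : K) : decode θ 0 = 0 := by
  simp [decode]

theorem decode_two_pow (θ : K) {n : ℕ} (hn : n < 5) : decode θ (2 ^ n) = θ ^ n := by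
  simp [decode, Nat.testBit_two_pow, hn]

variable [CharP K 2]

theorem decode_xor (θ : K) (m n : ℕ) : decode θ (m ^^^ n) = decode θ m + decode θ n := by
  simp only [decode, Nat.testBit_xor, ← Finset.sum_add_distrib]
  refine Finset.sum_congr rfl fun i _ => ?_
  cases m.testBit i <;> cases n.testBit i <;> simp [CharTwo.add_self_eq_zero]

variable {θ : K} (hθ : θ ^ 5 = θ ^ 2 + 1)
include hθ

theorem decode_exp {n : ℕ} (hn : n < 62) : decode θ (exp n) = θ ^ n := by
  induction n using Nat.strong_induction_on with
  | _ n ih =>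
    rcases Nat.lt_or_ge n 5 with h5 | h5
    · rw [exp_of_lt_five h5, decode_two_pow θ h5]
    · obtain ⟨m, rfl⟩ := Nat.exists_eq_add_of_le' h5
      rw [exp_add_five (by omega), decode_xor, ih _ (by omega) (by omega),
        ih _ (by omega) (by omega), pow_add, pow_add, hθ, mul_add, mul_one]

theorem decode_eq_pow_log {a : ℕ} (ha : a < 32) (ha0 : a ≠ 0) : decode θ a = θ ^ log a := by
  rw [← decode_exp hθ ((log_lt ha ha0).trans (by norm_num)), exp_log ha ha0]

theorem decode_mul {a b : ℕ} (ha : a < 32) (hb : b < 32) :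
    decode θ (mul a b) = decode θ a * decode θ b := by
  rcases eq_or_ne a 0 with rfl | ha0
  · rw [zero_mul hb, decode_zero, MulZeroClass.zero_mul]
  rcases eq_or_ne b 0 with rfl | hb0
  · rw [mul_zero ha, decode_zero, MulZeroClass.mul_zero]
  have := log_lt ha ha0
  have := log_lt hb hb0
  rw [mul, decode_exp hθ (by omega), decode_eq_pow_log hθ ha ha0, decode_eq_pow_log hθ hb hb0,
    pow_add]

theorem decode_eq_zero_iff {a : ℕ} (ha : a < 32) : decode θ a = 0 ↔ a = 0 := by
  refine ⟨fun h => ?_, fun h => h ▸ decode_zero θ⟩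
  by_contra ha0
  rw [decode_eq_pow_log hθ ha ha0] at h
  simp [eq_zero_of_pow_eq_zero h] at hθ

theorem decode_inj {a b : ℕ} (ha : a < 32) (hb : b < 32) : decode θ a = decode θ b ↔ a = b := by
  rw [← CharTwo.add_eq_zero, ← decode_xor, decode_eq_zero_iff hθ (xor_lt ha hb),
    Nat.xor_eq_zero_iff]

theorem exists_decode_eq (hK : Nat.card K = 2 ^ 5) (x : K) : ∃ a < 32, decode θ a = x := by
  have : Finite K := Nat.finite_of_card_ne_zero (by simp [hK])
  have hinj : Function.Injective fun a : Fin 32 => decode θ a :=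
    fun a b h => Fin.ext ((decode_inj hθ a.2 b.2).1 h)
  obtain ⟨a, ha⟩ := ((Nat.bijective_iff_injective_and_card _).2 ⟨hinj, by simp [hK]⟩).2 x
  exact ⟨a, a.2, ha⟩

theorem conjClass_eq_of_decode_eq_pow {a b : ℕ} (ha : a < 32) (hb : b < 32) {j : ℕ}
    (h : decode θ b = decode θ a ^ 2 ^ j) : conjClass b = conjClass a := by
  induction j generalizing a with
  | zero => rw [(decode_inj hθ hb ha).1 (by simpa using h)]
  | succ j ih =>
    rw [← conjClass_mul_self ha]
    refine ih (mul_lt ha ha) ?_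
    rw [h, decode_mul hθ ha ha, ← sq, ← pow_mul, pow_succ']

theorem decode_mem_range_artinSchreier_iff (hK : Nat.card K = 2 ^ 5) {a : ℕ} (ha : a < 32) :
    decode θ a ∈ (artinSchreier K).range ↔ (a ≠ 0 → conjClass a ≠ 0) := by
  rw [← exists_mul_self_xor_eq_iff ha, AddMonoidHom.mem_range]
  have happly {b : ℕ} (hb : b < 32) : decode θ (mul b b ^^^ b) = artinSchreier K (decode θ b) := by
    rw [decode_xor, decode_mul hθ hb hb, artinSchreier_apply, sq]
  constructor
  · rintro ⟨x, hx⟩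
    obtain ⟨b, hb, rfl⟩ := exists_decode_eq hθ hK x
    exact ⟨b, hb, (decode_inj hθ (xor_lt (mul_lt hb hb) hb) ha).1 ((happly hb).trans hx)⟩
  · rintro ⟨b, hb, rfl⟩
    exact ⟨_, (happly hb).symm⟩

theorem exists_equiv_points (hK : Nat.card K = 2 ^ 5) : ∃ e : {p // p ∈ points} ≃ HollmannPoint K,
    ∀ p, (e p).a = decode θ p.1.1 ∧ (e p).c = decode θ p.1.2 := by
  have : Finite K := Nat.finite_of_card_ne_zero (by simp [hK])
  have hmem {a c : ℕ} (ha : a < 32) (hc : c < 32) :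
      (a, c) ∈ points ↔ decode θ a * decode θ c ∉ (artinSchreier K).range := by
    rw [← decode_mul hθ ha hc, decode_mem_range_artinSchreier_iff hθ hK (mul_lt ha hc), mem_points]
    simp [ha, hc]
  have hexists (p : {p // p ∈ points}) :
      ∃ P : HollmannPoint K, P.a = decode θ p.1.1 ∧ P.c = decode θ p.1.2 :=
    have ⟨h₁, h₂, _⟩ := mem_points.1 p.2
    HollmannPoint.exists_coord ((hmem h₁ h₂).1 p.2)
  choose e he using hexists
  refine ⟨Equiv.ofBijective e ⟨fun p r h => ?_, fun P => ?_⟩, he⟩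
  · obtain ⟨hp₁, hp₂, -⟩ := mem_points.1 p.2
    obtain ⟨hr₁, hr₂, -⟩ := mem_points.1 r.2
    refine Subtype.ext (Prod.ext ((decode_inj hθ hp₁ hr₁).1 ?_) ((decode_inj hθ hp₂ hr₂).1 ?_))
    · rw [← (he p).1, ← (he r).1, h]
    · rw [← (he p).2, ← (he r).2, h]
  · obtain ⟨a, ha, hPa⟩ := exists_decode_eq hθ hK P.a
    obtain ⟨c, hc, hPc⟩ := exists_decode_eq hθ hK P.c
    have hp : (a, c) ∈ points := (hmem ha hc).2 (hPa ▸ hPc ▸ P.a_mul_c_notMem_range)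
    exact ⟨⟨_, hp⟩, HollmannPoint.ext_coord ((he _).1.trans hPa) ((he _).2.trans hPc)⟩

end Decode

/-- The conjugacy class of the invariant of two points. -/
def pairClass (p r : ℕ × ℕ) : ℕ := conjClass (pairCode p r)

theorem exists_equiv_points_pairClass {K : Type*} [Field K] [CharP K 2] (hK : Nat.card K = 2 ^ 5) :
    ∃ e : {p // p ∈ points} ≃ HollmannPoint K, ∀ p r p' r',
      (smallHollmannScheme K).toSetoid (e p, e r) (e p', e r') →
        pairClass p' r' = pairClass p r := by
  have : Finite K := Nat.finite_of_card_ne_zero (by simp [hK])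
  obtain ⟨θ, hθ⟩ := exists_quintic_root hK
  obtain ⟨e, he⟩ := exists_equiv_points hθ hK
  have hinv (p r) : (e p).inv (e r) = decode θ (pairCode p r) := by
    obtain ⟨hp₁, hp₂, -⟩ := mem_points.1 p.2
    obtain ⟨hr₁, hr₂, -⟩ := mem_points.1 r.2
    have h := xor_lt (mul_lt hp₁ hr₂) (mul_lt hr₁ hp₂)
    simp only [HollmannPoint.inv, he, pairCode, decode_xor, decode_mul hθ h h,
      decode_mul hθ hp₁ hr₂, decode_mul hθ hr₁ hp₂,
      decode_mul hθ (xor_lt hp₁ hr₁) (xor_lt hp₂ hr₂), sq]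
  refine ⟨e, fun p r p' r' h => ?_⟩
  obtain ⟨σ, hσ⟩ := HollmannPoint.exists_inv_eq_of_toSetoid h
  obtain ⟨j, hj⟩ := exists_forall_eq_pow_two_pow σ
  rw [hj, hinv, hinv] at hσ
  exact conjClass_eq_of_decode_eq_pow hθ (pairCode_lt p.2 r.2) (pairCode_lt p'.2 r'.2) hσ

/-- The classes of a point with three base points, as the base-four digits of a number. -/
def view (p : ℕ × ℕ) : ℕ :=
  pairClass (1, 1) p + 4 * (pairClass (1, 3) p + 4 * pairClass (2, 13) p)

/-- The points which the three base points see alike, with the common view `v`. -/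
def cell (v : ℕ) : List (ℕ × ℕ) := points.filter fun w => view w = v

/-- The number of points of a given view in a given class with `p`. -/
def count (v k : ℕ) (p : ℕ × ℕ) : ℕ := (cell v).countP fun w => pairClass w p = k

/-- Counts which separate the points of any given view. -/
def counts (p : ℕ × ℕ) : List ℕ := [count 62 1 p, count 62 2 p, count 55 1 p, count 55 2 p]

theorem nodup_map_counts_cell : ∀ v < 64, ((cell v).map counts).Nodup := by
  decide +kernel

theorem nodup_points : points.Nodup :=
  (List.nodup_range.product List.nodup_range).filter _

theorem view_lt (p : ℕ × ℕ) : view p < 64 := by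
  have h₁ := conjClass_lt (pairCode (1, 1) p)
  have h₂ := conjClass_lt (pairCode (1, 3) p)
  have h₃ := conjClass_lt (pairCode (2, 13) p)
  simp only [view, pairClass]
  omega

theorem ncard_eq_count {Ω : Type*} (e : {p // p ∈ points} ≃ Ω) (v k : ℕ) (r : ℕ × ℕ) :
    {w | view (e.symm w) = v ∧ pairClass (e.symm w) r = k}.ncard = count v k r := by
  rw [count, cell, List.countP_filter, List.countP_eq_length_filter,
    ← List.toFinset_card_of_nodup (nodup_points.filter _), ← Set.ncard_coe_finset,
    ← Set.ncard_image_of_injective _ (Subtype.val_injective.comp e.symm.injective)]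
  congr 1
  ext p
  simp only [Set.mem_image, Function.comp_apply, List.coe_toFinset, Set.mem_ofPred_eq,
    List.mem_filter, Bool.and_eq_true, decide_eq_true_eq]
  constructor
  · rintro ⟨w, ⟨hv, hk⟩, rfl⟩
    exact ⟨(e.symm w).2, hk, hv⟩
  · rintro ⟨hp, hk, hv⟩
    exact ⟨e ⟨p, hp⟩, by simp [hk, hv], by simp⟩

theorem eq_of_view_eq_of_counts_eq {p r : ℕ × ℕ} (hp : p ∈ points) (hr : r ∈ points)
    (hview : view p = view r) (hcounts : counts p = counts r) : p = r :=
  List.inj_on_of_nodup_map (nodup_map_counts_cell _ (view_lt r))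
    (List.mem_filter.2 ⟨hp, by simpa using hview⟩) (List.mem_filter.2 ⟨hr, by simp⟩) hcounts

theorem isDeterminedBy_three_of_equiv_points {Ω : Type*} [Finite Ω] {X : CoherentConfiguration Ω}
    (e : {p // p ∈ points} ≃ Ω)
    (he : ∀ p r p' r', X.toSetoid (e p, e r) (e p', e r') → pairClass p' r' = pairClass p r) :
    X.IsDeterminedBy 3 := by
  have h₁ : (1, 1) ∈ points := by decide +kernel
  have h₂ : (1, 3) ∈ points := by decide +kernel
  have h₃ : (2, 13) ∈ points := by decide +kernel
  let x : Fin 3 → Ω := ![e ⟨_, h₁⟩, e ⟨_, h₂⟩, e ⟨_, h₃⟩]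
  have hview {p r} (h : X.indist x 0 (e p) (e r)) : view p = view r := by
    have hclass (j : Fin 3) :=
      CoherentConfiguration.toSetoid_of_determined h (CoherentConfiguration.determined_apply j)
    rw [view, view, he _ _ _ _ (hclass 0), he _ _ _ _ (hclass 1), he _ _ _ _ (hclass 2)]
  have hcount {p r} (h : X.indist x 0 (e p) (e r)) (v k : ℕ) : count v k p = count v k r := by
    have hR : {q : Ω × Ω | pairClass (e.symm q.1) (e.symm q.2) = k} ∈ X.relations := by
      refine X.mem_relations_iff.2 fun q q' hq hk => ?_
      rw [Set.mem_ofPred_eq, ← hk]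
      exact he _ _ _ _ (by simpa using hq)
    have hW : ∀ w ∈ {w | view (e.symm w) = v}, ∀ w', X.indist x 0 w w' →
        w' ∈ {w | view (e.symm w) = v} := by
      intro w hw w' h
      rw [Set.mem_ofPred_eq, ← hw]
      exact (hview (by simpa using h)).symm
    simpa [← ncard_eq_count e] using CoherentConfiguration.ncard_eq_of_indist h hW hR
  refine CoherentConfiguration.isDeterminedBy_of_determined (x := x) (i := 0) fun w w' h => ?_
  obtain ⟨p, rfl⟩ := e.surjective w
  obtain ⟨r, rfl⟩ := e.surjective w'
  refine congrArg e (Subtype.ext (eq_of_view_eq_of_counts_eq r.2 p.2 (hview h).symm ?_))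
  simp only [counts, hcount h]

end GF32

theorem HollmannPoint.isDeterminedBy_of_card_thirty_two {K : Type*} [Field K] [CharP K 2]
    [Finite K] (hK : Nat.card K = 2 ^ 5) : (smallHollmannScheme K).IsDeterminedBy 3 := by
  obtain ⟨e, he⟩ := GF32.exists_equiv_points_pairClass hK
  exact GF32.isDeterminedBy_three_of_equiv_points e he

theorem eq_three_or_five_or_seventeen_le {d : ℕ} (hd : d.Prime) (hd3 : 3 ≤ d)
    (hd7 : d ≠ 7) (hd11 : d ≠ 11) (hd13 : d ≠ 13) : d = 3 ∨ d = 5 ∨ 17 ≤ d := by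
  by_contra! h
  have h17 := h.2.2
  interval_cases d <;> revert hd <;> first | omega | decide

theorem theorem1p3 (d : ℕ) (hd : d.Prime) (hd3 : 3 ≤ d)
    (hd7 : d ≠ 7) (hd11 : d ≠ 11) (hd13 : d ≠ 13)
    (K : Type*) [Field K] [Finite K] (hK : Nat.card K = 2 ^ d) :
    (smallHollmannScheme K).separabilityNumber ≤ 3 ∧
      (smallHollmannScheme K).IsDeterminedBy 3 := by
  have : CharP K 2 := charP_of_card hK
  have hdet : (smallHollmannScheme K).IsDeterminedBy 3 := by
    rcases eq_three_or_five_or_seventeen_le hd hd3 hd7 hd11 hd13 with rfl | rfl | hd17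
    · exact HollmannPoint.isDeterminedBy_of_card_eight hK
    · exact HollmannPoint.isDeterminedBy_of_card_thirty_two hK
    · exact HollmannPoint.isDeterminedBy_of_seventeen_le hd hd17 hK
  exact ⟨CoherentConfiguration.separabilityNumber_le (by norm_num) hdet, hdet⟩
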